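/- **Setting.** Let $(E_n,\mathcal E_n)_{n\ge 0}$ be measurable spaces, let $x_0\in E_0$, and let $(X_n)_{n\ge 0}$ be a Markov chain with $X_n\in E_n$, $X_0=x_0$ and (time-inhomogeneous) Markov transitions $K_n(x_{n-1},dx_n)$, $n\ge1$. Put $F_n=E_0\times\dots\times E_n$ and $Y_n=(X_0,\dots,X_n)\in F_n$, and let $M_n(y_{n-1},dy_n)$ be the Markov transitions of $(Y_n)$. Let $\mathcal B_b(F)$ be the set of bounded measurable functions $F\to\mathbb R$. For $n\ge1$ let $G_n:F_n\to(0,\infty)$ be measurable with $\sup_{y,y'\in F_n}G_n(y)/G_n(y')<\infty$. For $1\le p\le n$, $f\in\mathcal B_b(F_n)$ and $y_p\in F_p$ set $$\gamma_n(f)=\mathbb E\Big[f(Y_n)\prod_{1\le k<n}G_k(Y_k)\Big],\qquad \eta_n(f)=\frac{\gamma_n(f)}{\gamma_n(1)},\qquad Q_{p,n}(f)(y_p)=\mathbb E\Big[f(Y_n)\prod_{p\le k<n}G_k(Y_k)\,\Big|\,Y_p=y_p\Big],$$ the conditional expectation being computed with the transitions $K_n$. For $n\ge 2$ and a probability measure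 $\mu$ on $F_{n-1}$ let $\Phi_n(\mu)=\mu(G_{n-1})^{-1}\int\mu(dy)\,G_{n-1}(y)\,M_n(y,\cdot)$. For each $N\ge1$ let $(\xi_n)_{n\ge1}$, $\xi_n=(\xi_n^i)_{1\le i\le N}\in F_n^N$, be the $N$-particle system: a Markov chain such that $\xi_1^1,\dots,\xi_1^N$ are i.i.d. with law $\eta_1=M_1(x_0,\cdot)$ and, for $n\ge2$, given $(\xi_1,\dots,\xi_{n-1})$ the variables $\xi_n^1,\dots,\xi_n^N$ are i.i.d. with law $\Phi_n\big(\frac1N\sum_{i=1}^N\delta_{\xi_{n-1}^i}\big)$. The systems for different $N$ may live on different probability spaces. Set $$\eta_n^N=\frac1N\sum_{i=1}^N\delta_{\xi_n^i},\qquad \gamma_n^N(f)=\eta_n^N(f)\prod_{1\le p<n}\eta_p^N(G_p),$$ $$\mathcal W_n^{\gamma,N}(f)=\sqrt N\,[\gamma_n^N(f)-\gamma_n(f)],\qquad \mathcal W_n^{\eta,N}(f)=\sqrt N\,[\eta_n^N(f)-\eta_n(f)].$$ For fixed $n\ge1$ let $(\mathcal W_p)_{1\le p\le n}$ be independent centered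 Gaussian random fields on one probability space, $\mathcal W_p$ being indexed by $\mathcal B_b(F_p)$, with $\mathbb E[\mathcal W_p(f)\mathcal W_p(g)]=\eta_p\big([f-\eta_p(f)][g-\eta_p(g)]\big)$, and set $$\mathcal W_n^{\gamma}(f)=\sum_{p=1}^n\gamma_p(1)\,\mathcal W_p(Q_{p,n}f),\qquad \mathcal W_n^{\eta}(f)=\mathcal W_n^{\gamma}\Big(\frac1{\gamma_n(1)}\,(f-\eta_n(f))\Big).$$ **Lemma 2.4.** For any $n,d\ge1$, any $f^1,\dots,f^d\in\mathcal B_b(F_n)$ and any $(\nu^i)_{1\le i\le d}\in\{\gamma,\eta\}^d$, the random products $\prod_{i=1}^d\mathcal W_n^{\nu^i,N}(f^i)$ converge in law, as $N\to\infty$, to $\prod_{i=1}^d\mathcal W_n^{\nu^i}(f^i)$. In addition, all these products are integrable and $$\lim_{N\to\infty}\mathbb E\Big[\prod_{i=1}^d\mathcal W_n^{\nu^i,N}(f^i)\Big]=\mathbb E\Big[\prod_{i=1}^d\mathcal W_n^{\nu^i}(f^i)\Big].$$ -/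

import Mathlib

open MeasureTheory ProbabilityTheory Filter Topology Finset Preorder
open scoped ENNReal

noncomputable section

namespace FeynmanKac

universe u v w

/-- The path space `F_n = E_0 × ... × E_n`, with its product `σ`-algebra. -/
abbrev Path (E : ℕ → Type u) (n : ℕ) : Type u := (i : Finset.Iic n) → E i

/-- Membership in `B_b(F)`: bounded measurable real functions. -/
def BddMeas {F : Type u} [MeasurableSpace F] (f : F → ℝ) : Prop :=
  Measurable f ∧ ∃ C : ℝ, ∀ x, |f x| ≤ C

/-- The space `B_b(F)` as a type. -/
abbrev Bb (F : Type u) [MeasurableSpace F] : Type u := {f : F → ℝ // BddMeas f}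

/-- The empirical measure `N⁻¹ ∑ δ_{z^i}` of a configuration of `N` points. -/
def empirical {F : Type u} [MeasurableSpace F] {N : ℕ} (z : Fin N → F) : Measure F :=
  (N : ℝ≥0∞)⁻¹ • ∑ i, Measure.dirac (z i)

section Model

variable {E : ℕ → Type u} [∀ n, MeasurableSpace (E n)]

/-- The initial path `Y_0 = x_0`, an element of `F_0`. -/
def startPath (x₀ : E 0) : Path E 0 :=
  (MeasurableEquiv.piUnique (fun i : Finset.Iic 0 => E i)).symm x₀

/-- The transition `K_{n+1}(x_n, dx_{n+1})` of the chain `X`, read as a kernel from the whole past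
`(x_0, ..., x_n)`; it only depends on `x_n`. -/
def stepKernel (K : (n : ℕ) → Kernel (E n) (E (n + 1))) (n : ℕ) :
    Kernel (Path E n) (E (n + 1)) :=
  (K n).comap (fun y => y ⟨n, by simp⟩) (measurable_pi_apply _)

instance (K : (n : ℕ) → Kernel (E n) (E (n + 1))) [∀ n, IsMarkovKernel (K n)] (n : ℕ) :
    IsMarkovKernel (stepKernel K n) := by
  unfold stepKernel; infer_instance

variable (K : (n : ℕ) → Kernel (E n) (E (n + 1))) [∀ n, IsMarkovKernel (K n)]
  (G : (n : ℕ) → Path E n → ℝ) (x₀ : E 0)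

/-- The Markov transition `M_{n+1}(y_n, dy_{n+1})` of the historical process `Y_n = (X_0, ..., X_n)`:
keep the path and append a `K_{n+1}`-transition. -/
def pathKernel (n : ℕ) : Kernel (Path E n) (Path E (n + 1)) :=
  Kernel.partialTraj (stepKernel K) n (n + 1)

/-- The Feynman–Kac semigroup
`Q_{p,n}(f)(y) = 𝔼[f(Y_n) ∏_{p ≤ k < n} G_k(Y_k) | Y_p = y]`.
Here `Kernel.traj (stepKernel K) p y` is the law of the whole chain `(X_0, X_1, ...)` given `Y_p = y`
and `frestrictLe k x = (x_0, ..., x_k)`. -/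
def Q (p n : ℕ) (f : Path E n → ℝ) (y : Path E p) : ℝ :=
  ∫ x, f (frestrictLe (π := E) n x) * ∏ k ∈ Finset.Ico p n, G k (frestrictLe (π := E) k x)
    ∂(Kernel.traj (stepKernel K) p y)

/-- `γ_n(f) = 𝔼[f(Y_n) ∏_{1 ≤ k < n} G_k(Y_k)]`, for the chain started at `X_0 = x_0`. -/
def gam (n : ℕ) (f : Path E n → ℝ) : ℝ :=
  ∫ x, f (frestrictLe (π := E) n x) * ∏ k ∈ Finset.Ico 1 n, G k (frestrictLe (π := E) k x)
    ∂(Kernel.traj (stepKernel K) 0 (startPath x₀))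

/-- `η_n(f) = γ_n(f) / γ_n(1)`. -/
def eta (n : ℕ) (f : Path E n → ℝ) : ℝ :=
  gam K G x₀ n f / gam K G x₀ n (fun _ => 1)

/-- The nonlinear one-step map
`Φ_{n+1}(μ) = ∫ μ(dy) G_n(y) M_{n+1}(y, ·) / μ(G_n)`. -/
def Phi (n : ℕ) (μ : Measure (Path E n)) : Measure (Path E (n + 1)) :=
  (∫⁻ y, ENNReal.ofReal (G n y) ∂μ)⁻¹ •
    (μ.withDensity (fun y => ENNReal.ofReal (G n y))).bind (pathKernel K n)

/-- `ξ = (ξ_p)_{p ≥ 1}` is the interacting path-particle system with `N` particles: a Markov chain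
with `ξ_p ∈ F_p^N`, whose initial configuration `ξ_1` consists of `N` i.i.d. variables of law
`η_1 = M_1(x_0, ·)`, and such that, given `(ξ_1, ..., ξ_p)`, the `N` components of `ξ_{p+1}` are
i.i.d. with common law `Φ_{p+1}(m(ξ_p))`, `m(ξ_p)` being the empirical measure of `ξ_p`.
(The value `ξ 0` is a dummy.) -/
structure IsParticleSystem {Ω : Type v} [MeasurableSpace Ω] (P : Measure Ω) (N : ℕ)
    (ξ : (p : ℕ) → Ω → Fin N → Path E p) : Prop where
  measurable : ∀ p, 1 ≤ p → Measurable (ξ p)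
  init : P.map (ξ 1) = Measure.pi (fun _ : Fin N => pathKernel K 0 (startPath x₀))
  step : ∀ p, 1 ≤ p →
    ∀ A : Set ((q : Finset.Icc 1 p) → Fin N → Path E q), MeasurableSet A →
    ∀ B : Set (Fin N → Path E (p + 1)), MeasurableSet B →
      P ((fun ω (q : Finset.Icc 1 p) => ξ q ω) ⁻¹' A ∩ ξ (p + 1) ⁻¹' B) =
        ∫⁻ ω in (fun ω (q : Finset.Icc 1 p) => ξ q ω) ⁻¹' A,
          Measure.pi (fun _ : Fin N => Phi K G p (empirical (ξ p ω))) B ∂P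

/-- `(W_p)_{1 ≤ p ≤ n}` is a sequence of `n` independent centered Gaussian random fields, `W_p` being
indexed by `B_b(F_p)`, with
`𝔼[W_p(f) W_p(g)] = η_p([f - η_p(f)] [g - η_p(g)])`. -/
structure IsLimitField {Ω' : Type w} [MeasurableSpace Ω'] (P' : Measure Ω') (n : ℕ)
    (W : (p : ℕ) → (Path E p → ℝ) → Ω' → ℝ) : Prop where
  gaussian : ∀ p ∈ Finset.Icc 1 n, IsGaussianProcess (fun f : Bb (Path E p) => W p f) P'
  centered : ∀ p ∈ Finset.Icc 1 n, ∀ f : Path E p → ℝ, BddMeas f → ∫ ω, W p f ω ∂P' = 0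
  covariance : ∀ p ∈ Finset.Icc 1 n, ∀ f g : Path E p → ℝ, BddMeas f → BddMeas g →
    ∫ ω, W p f ω * W p g ω ∂P' =
      eta K G x₀ p (fun y => (f y - eta K G x₀ p f) * (g y - eta K G x₀ p g))
  indep : iIndepFun (fun (p : Finset.Icc 1 n) ω (f : Bb (Path E p)) => W p f ω) P'

/-- The two kinds of occupation measures, `{γ, η}`. -/
inductive Kind : Type
  | gamma : Kind
  | eta : Kind

section Particle

variable {Ω : Type v} {N : ℕ} (ξ : (p : ℕ) → Ω → Fin N → Path E p)

/-- `η_n^N(f) = N⁻¹ ∑ f(ξ_n^i)`, the occupation measure of the ancestral lines. -/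
def etaN (n : ℕ) (f : Path E n → ℝ) (ω : Ω) : ℝ :=
  ∫ y, f y ∂(empirical (ξ n ω))

/-- `γ_n^N(f) = η_n^N(f) ∏_{1 ≤ p < n} η_p^N(G_p)`. -/
def gamN (n : ℕ) (f : Path E n → ℝ) (ω : Ω) : ℝ :=
  etaN ξ n f ω * ∏ p ∈ Finset.Ico 1 n, etaN ξ p (G p) ω

/-- The fluctuation fields `W_n^{γ,N}(f) = √N [γ_n^N - γ_n](f)` and
`W_n^{η,N}(f) = √N [η_n^N - η_n](f)`. -/
def fluct (n : ℕ) : Kind → (Path E n → ℝ) → Ω → ℝ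
  | .gamma, f, ω => Real.sqrt N * (gamN G ξ n f ω - gam K G x₀ n f)
  | .eta, f, ω => Real.sqrt N * (etaN ξ n f ω - eta K G x₀ n f)

end Particle

/-- The limiting field `W_n^γ(f) = ∑_{p=1}^n γ_p(1) W_p(Q_{p,n} f)`. -/
def limitGam {Ω' : Type w} (W : (p : ℕ) → (Path E p → ℝ) → Ω' → ℝ) (n : ℕ)
    (f : Path E n → ℝ) (ω : Ω') : ℝ :=
  ∑ p ∈ Finset.Icc 1 n, gam K G x₀ p (fun _ => 1) * W p (Q K G p n f) ω

/-- The limiting Gaussian fields `W_n^γ(f)` and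
`W_n^η(f) = W_n^γ((f - η_n(f)) / γ_n(1))`. -/
def limitFluct {Ω' : Type w} (W : (p : ℕ) → (Path E p → ℝ) → Ω' → ℝ) (n : ℕ) :
    Kind → (Path E n → ℝ) → Ω' → ℝ
  | .gamma, f, ω => limitGam K G x₀ W n f ω
  | .eta, f, ω =>
      limitGam K G x₀ W n
        (fun y => 1 / gam K G x₀ n (fun _ => 1) * (f y - eta K G x₀ n f)) ω

end Model

end FeynmanKac

end

/-! Write `S g = G_n M_{n+1}(g)` (`stepOp`). The unnormalised measures evolve linearly, `γ_{n+1}(g)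
= γ_n(S g)`, and their particle versions obey the same rule up to a sampling error
(`fluct_gamma_succ`): `W_{n+1}^{γ,N}(g) = W_n^{γ,N}(S g) + γ_n^N(G_n) · √N [η_{n+1}^N(g) -
Φ_{n+1}(η_n^N)(g)]`. Given the past, the last term is a known bounded factor times a normalised
centred sum of bounded i.i.d. variables. Its conditional characteristic function is therefore within
`O(1/√N)` of `exp(-V_N/2)`, where `V_N = γ_n^N(G_n) γ_n^N(S g²) - γ_n^N(S g)²`. This is a polynomial
in the `γ_n^N`, so it lies within `O(1/√N)` in `L¹` of the same expression in `γ_n`. The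
characteristic function thus factorises asymptotically, the variances add, and induction on `n`
gives the Gaussian limit with an explicit rate (`exists_norm_charFun_fluct_sub_le`). The `L¹` bounds
needed there come from the same recursion: Hoeffding's lemma makes the exponential moments bounded
uniformly in `N` (`exists_integral_exp_fluct_le`), hence also all moments.

A linear combination of `γ`-fluctuations is the fluctuation of the combined function, so joint
convergence costs nothing more. An `η`-fluctuation equals `γ_n(1)/γ_n^N(1)` times a `γ`-fluctuation
(`fluct_eta_eq`). The ratio is bounded and differs from 1 by `O(1/√N)`, so replacing it by 1 costs
`O(1/√N)` in `L¹` (`exists_integral_abs_fluct_sub_le`). On the limit side, independence of the `W_p`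
yields the same characteristic function (`IsLimitField.integral_exp_sum_limitGam`).

Lévy continuity and continuous mapping then give convergence in law of products
(`tendstoInDistribution_prod_of_charFun`), and uniform second moments of the products upgrade it to
convergence of expectations (`tendsto_integral_of_tendstoInDistribution`). -/

noncomputable section

namespace FeynmanKac

universe u v w

/-! ### Bounded i.i.d. variables: characteristic functions and exponential moments. -/

section Generic

/-- Replacing the factors one at a time costs at most `‖a - b‖` each, so an `o(1/N)` error per
factor survives the `N`-th power. -/
lemma norm_pow_sub_pow_le_mul (a b : ℂ) (ha : ‖a‖ ≤ 1) (hb : ‖b‖ ≤ 1) (N : ℕ) :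
    ‖a ^ N - b ^ N‖ ≤ N * ‖a - b‖ := by
  induction N with
  | zero => simp
  | succ k ih =>
    have e : a ^ (k + 1) - b ^ (k + 1) = a ^ k * (a - b) + (a ^ k - b ^ k) * b := by ring
    rw [e]
    refine (norm_add_le _ _).trans ?_
    rw [norm_mul, norm_mul, norm_pow]
    have h1 : ‖a‖ ^ k ≤ 1 := pow_le_one₀ (norm_nonneg _) ha
    have h2 := norm_nonneg (a - b)
    have h3 := norm_nonneg (a ^ k - b ^ k)
    push_cast
    nlinarith [mul_le_mul_of_nonneg_right h1 h2, mul_le_mul_of_nonneg_left hb h3]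

lemma norm_exp_mul_I_sub_quadratic_le (x : ℝ) :
    ‖Complex.exp (x * Complex.I) - (1 + x * Complex.I - (x : ℂ) ^ 2 / 2)‖
      ≤ |x| ^ 3 * Real.exp |x| := by
  have h := Complex.norm_exp_sub_sum_le_norm_mul_exp (x * Complex.I) 3
  simp only [norm_mul, Complex.norm_real, Complex.norm_I, mul_one, Real.norm_eq_abs] at h
  refine le_trans (le_of_eq ?_) h
  congr 1
  simp [Finset.sum_range_succ, Nat.factorial, mul_pow]
  ring

/-- Second-order Taylor for `x ≤ 1`; for `x ≥ 1` the difference is at most `x ≤ x ^ 2`. -/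
lemma abs_exp_neg_sub_linear_le {x : ℝ} (hx : 0 ≤ x) : |Real.exp (-x) - (1 - x)| ≤ x ^ 2 := by
  have h1 := Real.one_sub_le_exp_neg x
  rw [abs_of_nonneg (by linarith)]
  rcases le_total x 1 with h | h
  · have := Real.abs_exp_sub_one_sub_id_le (x := -x) (by rwa [abs_neg, abs_of_nonneg hx])
    have h3 := le_abs_self (Real.exp (-x) - 1 - -x)
    nlinarith
  · have : Real.exp (-x) ≤ 1 := Real.exp_le_one_iff.2 (by linarith)
    nlinarith

variable {α : Type*} [MeasurableSpace α]

/-- Quantitative form of the central limit theorem for bounded centred variables, at the level of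
characteristic functions. -/
lemma norm_integral_exp_pow_sub_le (μ : Measure α) [IsProbabilityMeasure μ] {x : α → ℝ}
    (hx : Measurable x) {D : ℝ} (hD : ∀ a, |x a| ≤ D) (h0 : ∫ a, x a ∂μ = 0) {N : ℕ} (hN : 1 ≤ N) :
    ‖(∫ a, Complex.exp ((x a / Real.sqrt N : ℝ) * Complex.I) ∂μ) ^ N
        - (Real.exp (-(∫ a, x a ^ 2 ∂μ) / 2) : ℝ)‖
      ≤ (D ^ 3 * Real.exp D + D ^ 4) / Real.sqrt N := by
  obtain ⟨a0⟩ : Nonempty α := μ.nonempty_of_neZero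
  have hD0 : 0 ≤ D := (abs_nonneg _).trans (hD a0)
  have hN' : (1 : ℝ) ≤ N := by exact_mod_cast hN
  set s := Real.sqrt N with hs
  have hs2 : s ^ 2 = N := Real.sq_sqrt (by positivity)
  have hs1 : 1 ≤ s := Real.one_le_sqrt.2 hN'
  have hs0 : 0 < s := by linarith
  set v := ∫ a, x a ^ 2 ∂μ with hv
  have ib : ∀ {h : α → ℝ}, Measurable h → ∀ C, (∀ a, |h a| ≤ C) → Integrable h μ :=
    fun hm C hC => Integrable.of_bound hm.aestronglyMeasurable C
      (Eventually.of_forall fun a => by simpa using hC a)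
  have ix : Integrable x μ := ib hx D hD
  have ix2 : Integrable (fun a => x a ^ 2) μ := ib (hx.pow_const 2) (D ^ 2) fun a => by
    rw [abs_pow]; exact pow_le_pow_left₀ (abs_nonneg _) (hD a) 2
  have hv0 : 0 ≤ v := integral_nonneg fun a => sq_nonneg _
  have hvD : v ≤ D ^ 2 := by
    have := integral_mono ix2 (integrable_const (D ^ 2)) (μ := μ) fun a => by
      rw [← sq_abs]; exact pow_le_pow_left₀ (abs_nonneg _) (hD a) 2
    simpa using this
  have ie : Integrable (fun a => Complex.exp ((x a / s : ℝ) * Complex.I)) μ :=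
    Integrable.of_bound (by fun_prop) 1 (Eventually.of_forall fun a => by
      rw [Complex.norm_exp_ofReal_mul_I])
  set A := ∫ a, Complex.exp ((x a / s : ℝ) * Complex.I) ∂μ with hA
  -- The `N`-th root of the Gaussian limit. Both `A` and `b` are compared with the quadratic
  -- approximation `1 - v / (2N)`, with errors `O(N^(-3/2))`.
  set b : ℝ := Real.exp (-(v / (2 * N))) with hb
  have hbN : ((Real.exp (-v / 2) : ℝ) : ℂ) = (b : ℂ) ^ N := by
    rw [← Complex.ofReal_pow, hb, ← Real.exp_nat_mul]
    congr 2; field_simp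
  have hA1 : ‖A‖ ≤ 1 := by
    refine (norm_integral_le_of_norm_le_const (C := 1) (Eventually.of_forall fun a => ?_)).trans ?_
    · rw [Complex.norm_exp_ofReal_mul_I]
    · simp
  have hb1 : ‖(b : ℂ)‖ ≤ 1 := by
    rw [Complex.norm_real, Real.norm_eq_abs, abs_of_pos (Real.exp_pos _)]
    exact Real.exp_le_one_iff.2 (neg_nonpos.2 (by positivity))
  have hquad : ∫ a, (1 + ((x a / s : ℝ) : ℂ) * Complex.I - ((x a / s : ℝ) : ℂ) ^ 2 / 2) ∂μ
      = ((1 - v / (2 * N) : ℝ) : ℂ) := by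
    have i1 : Integrable (fun a => ((x a / s : ℝ) : ℂ) * Complex.I) μ :=
      ((ix.div_const s).ofReal (𝕜 := ℂ)).mul_const _
    have i2 : Integrable (fun a => ((x a / s : ℝ) : ℂ) ^ 2 / 2) μ := by
      have := ((ix2.div_const (s ^ 2)).ofReal (𝕜 := ℂ)).div_const 2
      refine this.congr (Eventually.of_forall fun a => ?_)
      simp [div_pow]
    have i3 : Integrable (fun a => 1 + ((x a / s : ℝ) : ℂ) * Complex.I) μ :=
      (integrable_const _).add i1
    rw [integral_sub i3 i2, integral_add (integrable_const _) i1,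
      integral_mul_const, integral_div]
    have e1 : ∫ a, ((x a / s : ℝ) : ℂ) ∂μ = 0 := by
      rw [integral_complex_ofReal, integral_div, h0]; simp
    have e2 : ∫ a, ((x a / s : ℝ) : ℂ) ^ 2 ∂μ = ((v / N : ℝ) : ℂ) := by
      rw [hv, ← integral_div, ← integral_complex_ofReal]
      refine integral_congr_ae (Eventually.of_forall fun a => ?_)
      simp only [← Complex.ofReal_pow, div_pow, hs2]
    rw [e1, e2]; simp; field_simp
  have hAq : ‖A - ((1 - v / (2 * N) : ℝ) : ℂ)‖ ≤ (D / s) ^ 3 * Real.exp D := by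
    rw [← hquad, hA, ← integral_sub ie]
    · refine (norm_integral_le_of_norm_le_const (C := (D / s) ^ 3 * Real.exp D)
        (Eventually.of_forall fun a => ?_)).trans (by simp)
      refine (norm_exp_mul_I_sub_quadratic_le _).trans ?_
      have h1 : |x a / s| ≤ D / s := by
        rw [abs_div, abs_of_pos hs0]; gcongr; exact hD a
      have h2 : |x a / s| ≤ D := h1.trans (div_le_self hD0 hs1)
      gcongr
    · refine Integrable.of_bound (by fun_prop) (1 + D + D ^ 2) (Eventually.of_forall fun a => ?_)
      have h1 : |x a / s| ≤ D := by
        rw [abs_div, abs_of_pos hs0]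
        exact (div_le_self (abs_nonneg _) hs1).trans (hD a)
      refine (norm_sub_le _ _).trans ?_
      refine add_le_add ((norm_add_le _ _).trans ?_) ?_
      · simpa only [norm_one, norm_mul, Complex.norm_I, mul_one, Complex.norm_real,
          Real.norm_eq_abs, add_le_add_iff_left] using h1
      · rw [norm_div, norm_pow, Complex.norm_real, Real.norm_eq_abs]
        have : |x a / s| ^ 2 ≤ D ^ 2 := pow_le_pow_left₀ (abs_nonneg _) h1 2
        simp only [Complex.norm_ofNat]
        nlinarith [sq_nonneg (|x a / s|)]
  have hbq : ‖((1 - v / (2 * N) : ℝ) : ℂ) - b‖ ≤ (v / (2 * N)) ^ 2 := by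
    rw [← Complex.ofReal_sub, Complex.norm_real, Real.norm_eq_abs, abs_sub_comm]
    exact abs_exp_neg_sub_linear_le (by positivity)
  rw [hbN]
  refine (norm_pow_sub_pow_le_mul A b hA1 hb1 N).trans ?_
  have htri : ‖A - b‖ ≤ (D / s) ^ 3 * Real.exp D + (v / (2 * N)) ^ 2 := by
    calc ‖A - b‖ = ‖(A - ((1 - v / (2 * N) : ℝ) : ℂ)) + (((1 - v / (2 * N) : ℝ) : ℂ) - b)‖ := by
          congr 1; ring
      _ ≤ _ := (norm_add_le _ _).trans (add_le_add hAq hbq)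
  have hvN : (v / (2 * N)) ^ 2 ≤ D ^ 4 / (N * s) := by
    have h1 : v ^ 2 ≤ D ^ 4 := by
      calc v ^ 2 ≤ (D ^ 2) ^ 2 := pow_le_pow_left₀ hv0 hvD 2
        _ = D ^ 4 := by ring
    have h2 : N * s ≤ (2 * (N : ℝ)) ^ 2 := by
      have : s ≤ N := by rw [← hs2]; nlinarith
      nlinarith
    rw [div_pow]
    exact div_le_div₀ (by positivity) h1 (by positivity) h2
  calc (N : ℝ) * ‖A - b‖ ≤ N * ((D / s) ^ 3 * Real.exp D + D ^ 4 / (N * s)) := by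
        gcongr; exact htri.trans (by gcongr)
    _ = _ := by
        have : (N : ℝ) ≠ 0 := by positivity
        rw [← hs2]; field_simp

/-- Hoeffding's lemma: a centred variable in `[-D, D]` is sub-Gaussian with parameter `D ^ 2`, so
each of the `N` factors is at most `exp(D ^ 2 / (2N))`. -/
lemma integral_exp_pow_le (μ : Measure α) [IsProbabilityMeasure μ] {x : α → ℝ}
    (hx : Measurable x) {D : ℝ} (hD : ∀ a, |x a| ≤ D) (h0 : ∫ a, x a ∂μ = 0) {N : ℕ} (hN : 1 ≤ N) :
    (∫ a, Real.exp (x a / Real.sqrt N) ∂μ) ^ N ≤ Real.exp (D ^ 2 / 2) := by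
  obtain ⟨a0⟩ : Nonempty α := μ.nonempty_of_neZero
  have hD0 : 0 ≤ D := (abs_nonneg _).trans (hD a0)
  have h := (hasSubgaussianMGF_of_mem_Icc (μ := μ) (X := x) (a := -D) (b := D) hx.aemeasurable
    (Eventually.of_forall fun a => abs_le.1 (hD a))).mgf_le (1 / Real.sqrt N)
  simp only [h0, sub_zero, mgf] at h
  have hN' : (0 : ℝ) < N := by exact_mod_cast hN
  have e : ∫ a, Real.exp (x a / Real.sqrt N) ∂μ ≤ Real.exp (D ^ 2 / (2 * N)) := by
    convert h using 2
    · ext a; congr 1; ring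
    · have : ‖D - -D‖ = 2 * D := by
        rw [Real.norm_eq_abs, abs_of_nonneg (by linarith)]; ring
      push_cast
      rw [this, div_pow, div_pow, one_pow, Real.sq_sqrt hN'.le]
      field_simp
  calc _ ≤ (Real.exp (D ^ 2 / (2 * N))) ^ N :=
        pow_le_pow_left₀ (integral_nonneg fun a => (Real.exp_pos _).le) e N
    _ = _ := by rw [← Real.exp_nat_mul]; congr 1; field_simp

/-- The empirical mean `N⁻¹ ∑ f(z^i)`. -/
def avg {β : Type*} {N : ℕ} (z : Fin N → β) (f : β → ℝ) : ℝ := (N : ℝ)⁻¹ * ∑ i, f (z i)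

lemma measurable_avg {N : ℕ} {f : α → ℝ} (hf : Measurable f) :
    Measurable fun z : Fin N → α => avg z f := by
  unfold avg; fun_prop

lemma mul_sqrt_mul_avg_sub {β : Type*} {N : ℕ} (hN : 1 ≤ N) (z : Fin N → β) (g : β → ℝ) (θ m : ℝ) :
    θ * (Real.sqrt N * (avg z g - m)) = ∑ i, θ * (g (z i) - m) / Real.sqrt N := by
  have hN' : (0 : ℝ) < N := by exact_mod_cast hN
  have h2 : Real.sqrt N ^ 2 = N := Real.sq_sqrt hN'.le
  have h3 : 0 < Real.sqrt N := Real.sqrt_pos.2 hN'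
  rw [← Finset.sum_div, ← Finset.mul_sum, Finset.sum_sub_distrib, avg]
  simp only [Finset.sum_const, Finset.card_univ, Fintype.card_fin, nsmul_eq_mul]
  generalize hS : ∑ i, g (z i) = S
  have h4 : θ * (Real.sqrt N * ((N : ℝ)⁻¹ * S - m)) = θ * (S - N * m) * (Real.sqrt N / N) := by
    field_simp
  rw [h4, Real.sqrt_div_self, div_eq_mul_inv]

section Centred

variable {μ : Measure α} [IsProbabilityMeasure μ] {g : α → ℝ} {B T θ : ℝ}

lemma integrable_of_abs_le (hg : Measurable g) (hB : ∀ a, |g a| ≤ B) : Integrable g μ :=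
  Integrable.of_bound hg.aestronglyMeasurable B (Eventually.of_forall fun a => by simpa using hB a)

lemma abs_integral_le_of_abs_le (hB : ∀ a, |g a| ≤ B) : |∫ a, g a ∂μ| ≤ B := by
  simpa using norm_integral_le_of_norm_le_const (μ := μ) (f := g) (C := B)
    (Eventually.of_forall fun a => by simpa using hB a)

lemma abs_mul_sub_integral_le (hB : ∀ a, |g a| ≤ B) (hθ : |θ| ≤ T) (a : α) :
    |θ * (g a - ∫ a, g a ∂μ)| ≤ T * (2 * B) := by
  rw [abs_mul]
  have h1 : |g a - ∫ a, g a ∂μ| ≤ 2 * B :=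
    (abs_sub _ _).trans (by linarith [hB a, abs_integral_le_of_abs_le (μ := μ) hB])
  exact mul_le_mul hθ h1 (abs_nonneg _) ((abs_nonneg _).trans hθ)

lemma integral_mul_sub_integral (hg : Measurable g) (hB : ∀ a, |g a| ≤ B) :
    ∫ a, θ * (g a - ∫ a, g a ∂μ) ∂μ = 0 := by
  rw [integral_const_mul, integral_sub (integrable_of_abs_le hg hB) (integrable_const _)]
  simp

lemma integral_sq_mul_sub_integral (hg : Measurable g) (hB : ∀ a, |g a| ≤ B) :
    ∫ a, (θ * (g a - ∫ a, g a ∂μ)) ^ 2 ∂μ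
      = θ ^ 2 * (∫ a, g a ^ 2 ∂μ - (∫ a, g a ∂μ) ^ 2) := by
  set m := ∫ a, g a ∂μ with hm
  have i1 : Integrable (fun a => g a ^ 2) μ :=
    integrable_of_abs_le (B := B ^ 2) (hg.pow_const 2) fun a => by
      rw [abs_pow]; exact pow_le_pow_left₀ (abs_nonneg _) (hB a) 2
  have i2 : Integrable (fun a => 2 * m * g a) μ := (integrable_of_abs_le hg hB).const_mul _
  have i3 : Integrable (fun a => g a ^ 2 - 2 * m * g a) μ := i1.sub i2
  have e : ∀ a, (θ * (g a - m)) ^ 2 = θ ^ 2 * (g a ^ 2 - 2 * m * g a + m ^ 2) := fun a => by ring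
  simp_rw [e]
  rw [integral_const_mul, integral_add i3 (integrable_const _), integral_sub i1 i2,
    integral_const_mul, ← hm]
  simp; ring_nf; simp

/-- Central limit bound for the empirical mean of an i.i.d. sample of law `μ`. -/
lemma norm_integral_pi_exp_sub_le (hg : Measurable g) (hB : ∀ a, |g a| ≤ B) (hθ : |θ| ≤ T)
    {N : ℕ} (hN : 1 ≤ N) :
    ‖∫ z, Complex.exp ((θ * (Real.sqrt N * (avg z g - ∫ a, g a ∂μ)) : ℝ) * Complex.I)
        ∂(Measure.pi fun _ : Fin N => μ)
        - (Real.exp (-(θ ^ 2 * (∫ a, g a ^ 2 ∂μ - (∫ a, g a ∂μ) ^ 2)) / 2) : ℝ)‖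
      ≤ ((T * (2 * B)) ^ 3 * Real.exp (T * (2 * B)) + (T * (2 * B)) ^ 4) / Real.sqrt N := by
  have h := norm_integral_exp_pow_sub_le μ (x := fun a => θ * (g a - ∫ a, g a ∂μ))
    (by fun_prop) (abs_mul_sub_integral_le hB hθ) (integral_mul_sub_integral hg hB) hN
  rw [integral_sq_mul_sub_integral hg hB] at h
  have e := integral_fintype_prod_eq_pow (ι := Fin N) (μ := μ)
    (f := fun a => Complex.exp ((θ * (g a - ∫ a, g a ∂μ) / Real.sqrt N : ℝ) * Complex.I))
  rw [Fintype.card_fin] at e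
  rw [← e] at h
  refine le_of_eq_of_le ?_ h
  congr 2
  refine integral_congr_ae (Eventually.of_forall fun z => ?_)
  simp only
  rw [mul_sqrt_mul_avg_sub hN, ← Complex.exp_sum, Complex.ofReal_sum, Finset.sum_mul]

lemma integral_pi_exp_le (hg : Measurable g) (hB : ∀ a, |g a| ≤ B) (hθ : |θ| ≤ T)
    {N : ℕ} (hN : 1 ≤ N) :
    ∫ z, Real.exp (θ * (Real.sqrt N * (avg z g - ∫ a, g a ∂μ))) ∂(Measure.pi fun _ : Fin N => μ)
      ≤ Real.exp ((T * (2 * B)) ^ 2 / 2) := by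
  have h := integral_exp_pow_le μ (x := fun a => θ * (g a - ∫ a, g a ∂μ))
    (by fun_prop) (abs_mul_sub_integral_le hB hθ) (integral_mul_sub_integral hg hB) hN
  have e := integral_fintype_prod_eq_pow (ι := Fin N) (μ := μ)
    (f := fun a => Real.exp (θ * (g a - ∫ a, g a ∂μ) / Real.sqrt N))
  rw [Fintype.card_fin] at e
  rw [← e] at h
  refine le_of_eq_of_le ?_ h
  refine integral_congr_ae (Eventually.of_forall fun z => ?_)
  simp only
  rw [mul_sqrt_mul_avg_sub hN, ← Real.exp_sum]

end Centred

/-! ### From characteristic functions to laws and expectations of products. -/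

section Convergence

variable {Ω : ℕ → Type*} [∀ N, MeasurableSpace (Ω N)] {P : (N : ℕ) → Measure (Ω N)}
  [∀ N, IsProbabilityMeasure (P N)] {Ω' : Type*} [MeasurableSpace Ω'] {P' : Measure Ω'}
  [IsProbabilityMeasure P']

/-- The clipping error vanishes on `[-R, R]` and is at most `|x| ≤ x ^ 2 / R` outside. A second
moment thus controls truncation. -/
lemma abs_sub_clip_le {R : ℝ} (hR : 0 < R) (x : ℝ) : |x - max (-R) (min x R)| ≤ x ^ 2 / R := by
  rw [le_div_iff₀ hR]
  rcases le_total x R with h | h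
  · rcases le_total (-R) x with h' | h'
    · rw [min_eq_left h, max_eq_right h']; simp; positivity
    · rw [min_eq_left h, max_eq_left h', abs_of_nonpos (by linarith)]; nlinarith
  · rw [min_eq_right h, max_eq_right (by linarith), abs_of_nonneg (by linarith)]; nlinarith

lemma abs_integral_sub_integral_clip_le {Ω : Type*} [MeasurableSpace Ω] {P : Measure Ω}
    [IsProbabilityMeasure P] {X : Ω → ℝ} (hX : AEMeasurable X P)
    (h2 : Integrable (fun ω => X ω ^ 2) P) {R : ℝ} (hR : 0 < R) :
    |∫ ω, X ω ∂P - ∫ ω, max (-R) (min (X ω) R) ∂P| ≤ (∫ ω, X ω ^ 2 ∂P) / R := by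
  have h1 : Integrable X P := by
    refine MemLp.integrable one_le_two ((memLp_two_iff_integrable_sq hX.aestronglyMeasurable).2 h2)
  have h3 : Integrable (fun ω => max (-R) (min (X ω) R)) P :=
    Integrable.of_bound (by fun_prop) R (Eventually.of_forall fun ω => by
      rw [Real.norm_eq_abs, abs_le]
      exact ⟨le_max_left _ _, max_le (by linarith) (min_le_right _ _)⟩)
  rw [← integral_sub h1 h3, ← integral_div]
  exact norm_integral_le_of_norm_le (f := fun ω => X ω - max (-R) (min (X ω) R)) (h2.div_const R)
    (Eventually.of_forall fun ω => abs_sub_clip_le hR _)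

/-- Convergence in distribution together with a uniform bound on second moments implies the
convergence of expectations. -/
lemma tendsto_integral_of_tendstoInDistribution {X : (N : ℕ) → Ω N → ℝ} {Z : Ω' → ℝ}
    (h : TendstoInDistribution X atTop Z P P') {C : ℝ}
    (hX : ∀ᶠ N in atTop, Integrable (fun ω => X N ω ^ 2) (P N) ∧ ∫ ω, X N ω ^ 2 ∂(P N) ≤ C)
    (hZ : Integrable (fun ω => Z ω ^ 2) P') :
    Tendsto (fun N => ∫ ω, X N ω ∂(P N)) atTop (𝓝 (∫ ω, Z ω ∂P')) := by
  have hZm := h.aemeasurable_limit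
  have hXm := h.forall_aemeasurable
  have ht := ProbabilityMeasure.tendsto_iff_forall_integral_tendsto.1 h.tendsto
  have hclip : ∀ R : ℝ, 0 < R →
      Tendsto (fun N => ∫ ω, max (-R) (min (X N ω) R) ∂(P N)) atTop
        (𝓝 (∫ ω, max (-R) (min (Z ω) R) ∂P')) := by
    intro R hR
    have hc : Continuous fun x : ℝ => max (-R) (min x R) := by fun_prop
    have := ht (BoundedContinuousFunction.ofNormedAddCommGroup (fun x : ℝ => max (-R) (min x R))
      hc R fun x => by
        rw [Real.norm_eq_abs, abs_le]
        exact ⟨le_max_left _ _, max_le (by linarith) (min_le_right _ _)⟩)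
    simp only [BoundedContinuousFunction.coe_ofNormedAddCommGroup, ProbabilityMeasure.coe_mk] at this
    rw [integral_map hZm hc.aestronglyMeasurable] at this
    refine this.congr fun N => ?_
    rw [integral_map (hXm N) hc.aestronglyMeasurable]
  rw [Metric.tendsto_nhds]
  intro ε hε
  -- `A` dominates the sum of the two second moments, so with this `R` both truncation errors
  -- together stay below `ε / 2`.
  set A : ℝ := max C 0 + ∫ ω, Z ω ^ 2 ∂P' with hA
  have hA0 : 0 ≤ ∫ ω, Z ω ^ 2 ∂P' := integral_nonneg fun ω => sq_nonneg _
  set R : ℝ := 2 * (A + 1) / ε with hR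
  have hR0 : 0 < R := by positivity
  have hAR : A / R < ε / 2 := by
    rw [hR, div_lt_iff₀ (by positivity)]; field_simp; linarith
  filter_upwards [hX, (Metric.tendsto_nhds.1 (hclip R hR0)) (ε / 2) (by positivity)]
    with N ⟨hN1, hN2⟩ hN3
  have a1 := abs_integral_sub_integral_clip_le (hXm N) hN1 hR0
  have a2 := abs_integral_sub_integral_clip_le hZm hZ hR0
  have a3 : (∫ ω, X N ω ^ 2 ∂(P N)) / R + (∫ ω, Z ω ^ 2 ∂P') / R ≤ A / R := by
    rw [← add_div]; gcongr; exact add_le_add_left (hN2.trans (le_max_left _ _)) _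
  rw [Real.dist_eq] at hN3 ⊢
  rw [abs_le] at a1 a2
  rw [abs_lt] at hN3 ⊢
  constructor <;> linarith [a1.1, a1.2, a2.1, a2.2, hN3.1, hN3.2]

/-- Cramér–Wold and continuous mapping for products: if all linear combinations have converging
characteristic functions, the product converges in distribution. -/
lemma tendstoInDistribution_prod_of_charFun {d : ℕ} {X : (N : ℕ) → Fin d → Ω N → ℝ}
    {Z : Fin d → Ω' → ℝ} (hX : ∀ N i, AEMeasurable (X N i) (P N))
    (hZ : ∀ i, AEMeasurable (Z i) P')
    (h : ∀ u : Fin d → ℝ,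
      Tendsto (fun N => ∫ ω, Complex.exp ((∑ i, u i * X N i ω : ℝ) * Complex.I) ∂(P N)) atTop
        (𝓝 (∫ ω, Complex.exp ((∑ i, u i * Z i ω : ℝ) * Complex.I) ∂P'))) :
    TendstoInDistribution (fun N ω => ∏ i, X N i ω) atTop (fun ω => ∏ i, Z i ω) P P' := by
  have mX : ∀ N, AEMeasurable (fun ω => (WithLp.toLp 2 fun i => X N i ω : EuclideanSpace ℝ (Fin d)))
      (P N) := fun N => (WithLp.measurable_toLp 2 _).comp_aemeasurable
        (aemeasurable_pi_lambda _ (hX N))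
  have mZ : AEMeasurable (fun ω => (WithLp.toLp 2 fun i => Z i ω : EuclideanSpace ℝ (Fin d))) P' :=
    (WithLp.measurable_toLp 2 _).comp_aemeasurable (aemeasurable_pi_lambda _ hZ)
  have key : TendstoInDistribution
      (fun N ω => (WithLp.toLp 2 fun i => X N i ω : EuclideanSpace ℝ (Fin d))) atTop
      (fun ω => (WithLp.toLp 2 fun i => Z i ω : EuclideanSpace ℝ (Fin d))) P P' := by
    refine ⟨mX, mZ, ProbabilityMeasure.tendsto_of_tendsto_charFun fun t => ?_⟩
    simp only [ProbabilityMeasure.coe_mk, charFun_apply]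
    rw [integral_map mZ (by fun_prop)]
    refine ((h fun i => t i).congr fun N => ?_).trans (le_of_eq ?_)
    · rw [integral_map (mX N) (by fun_prop)]
      simp [PiLp.inner_apply]
    · simp [PiLp.inner_apply]
  exact key.continuous_comp (g := fun x : EuclideanSpace ℝ (Fin d) => ∏ i, x i) (by fun_prop)

end Convergence

end Generic

/-! ### Stability of bounded measurable functions. -/

section BddMeas

variable {F : Type*} [MeasurableSpace F] {f g : F → ℝ}

lemma BddMeas.const (c : ℝ) : BddMeas fun _ : F => c :=
  ⟨measurable_const, |c|, fun _ => le_rfl⟩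

lemma BddMeas.mul (hf : BddMeas f) (hg : BddMeas g) : BddMeas fun x => f x * g x := by
  obtain ⟨mf, C, hC⟩ := hf
  obtain ⟨mg, D, hD⟩ := hg
  refine ⟨mf.mul mg, C * D, fun x => ?_⟩
  rw [abs_mul]
  exact mul_le_mul (hC x) (hD x) (abs_nonneg _) ((abs_nonneg _).trans (hC x))

lemma BddMeas.add (hf : BddMeas f) (hg : BddMeas g) : BddMeas fun x => f x + g x := by
  obtain ⟨mf, C, hC⟩ := hf
  obtain ⟨mg, D, hD⟩ := hg
  exact ⟨mf.add mg, C + D, fun x => (abs_add_le _ _).trans (add_le_add (hC x) (hD x))⟩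

lemma BddMeas.sub (hf : BddMeas f) (hg : BddMeas g) : BddMeas fun x => f x - g x := by
  simpa [sub_eq_add_neg] using hf.add ((BddMeas.const (-1)).mul hg)

lemma BddMeas.abs (hf : BddMeas f) : BddMeas fun x => |f x| :=
  ⟨hf.1.abs, hf.2.imp fun _ h x => by rw [abs_abs]; exact h x⟩

lemma BddMeas.pow (hf : BddMeas f) (k : ℕ) : BddMeas fun x => f x ^ k := by
  induction k with
  | zero => simpa using BddMeas.const 1
  | succ k ih => simpa [pow_succ] using ih.mul hf

lemma BddMeas.sq (hf : BddMeas f) : BddMeas fun x => f x ^ 2 := hf.pow 2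

lemma BddMeas.prod {ι : Type*} (s : Finset ι) {f : ι → F → ℝ} (hf : ∀ i ∈ s, BddMeas (f i)) :
    BddMeas fun x => ∏ i ∈ s, f i x := by
  classical
  induction s using Finset.induction_on with
  | empty => simpa using BddMeas.const 1
  | insert a s ha ih =>
    simp_rw [Finset.prod_insert ha]
    exact (hf a (by simp)).mul (ih fun i hi => hf i (by simp [hi]))

lemma BddMeas.sum {ι : Type*} (s : Finset ι) {f : ι → F → ℝ} (hf : ∀ i ∈ s, BddMeas (f i)) :
    BddMeas fun x => ∑ i ∈ s, f i x := by
  classical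
  induction s using Finset.induction_on with
  | empty => simpa using BddMeas.const 0
  | insert a s ha ih =>
    simp_rw [Finset.sum_insert ha]
    exact (hf a (by simp)).add (ih fun i hi => hf i (by simp [hi]))

lemma BddMeas.comp {F' : Type*} [MeasurableSpace F'] (hf : BddMeas f) {φ : F' → F}
    (hφ : Measurable φ) : BddMeas fun x => f (φ x) :=
  ⟨hf.1.comp hφ, hf.2.imp fun _ h _ => h _⟩

lemma BddMeas.integrable (hf : BddMeas f) (μ : Measure F) [IsFiniteMeasure μ] : Integrable f μ :=
  hf.2.elim fun C hC => Integrable.of_bound hf.1.aestronglyMeasurable C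
    (Eventually.of_forall fun a => by simpa using hC a)

lemma BddMeas.kernelIntegral {F' : Type*} [MeasurableSpace F'] (hf : BddMeas f)
    (κ : Kernel F' F) [IsMarkovKernel κ] : BddMeas fun y => ∫ x, f x ∂(κ y) := by
  refine ⟨(hf.1.stronglyMeasurable.integral_kernel (κ := κ)).measurable, ?_⟩
  obtain ⟨C, hC⟩ := hf.2
  exact ⟨C, fun y => abs_integral_le_of_abs_le hC⟩

lemma BddMeas.exists_pos_bound (hf : BddMeas f) : ∃ C, 0 < C ∧ ∀ x, |f x| ≤ C :=
  hf.2.elim fun C hC => ⟨max C 1, by positivity, fun x => (hC x).trans (le_max_left _ _)⟩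

end BddMeas

/-! ### Potentials and the Feynman–Kac semigroup. -/

section Semigroup

variable {E : ℕ → Type u} [∀ n, MeasurableSpace (E n)]
  (K : (n : ℕ) → Kernel (E n) (E (n + 1))) [∀ n, IsMarkovKernel (K n)]
  (G : (n : ℕ) → Path E n → ℝ) (x₀ : E 0)

/-- Measurable potentials bounded above and away from zero. -/
structure BddPotentials : Prop where
  measurable : ∀ n, 1 ≤ n → Measurable (G n)
  bounds : ∀ n, 1 ≤ n → ∃ c C : ℝ, 0 < c ∧ ∀ y, c ≤ G n y ∧ G n y ≤ C

instance (n : ℕ) : IsMarkovKernel (pathKernel K n) := by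
  unfold pathKernel; infer_instance

include K x₀ in
lemma nonempty_path (n : ℕ) : Nonempty (Path E n) := by
  obtain ⟨x⟩ : Nonempty (∀ i, E i) :=
    (Kernel.traj (stepKernel K) 0 (startPath x₀)).nonempty_of_neZero
  exact ⟨frestrictLe (π := E) n x⟩

variable {G}

include K x₀ in
-- With a reference path `y₀`, the ratio bound applied to `(y, y₀)` and to `(y₀, y)` encloses `G n
-- y` between `G n y₀ / C` and `C * G n y₀`.
lemma bddPotentials_of_ratio (hGmeas : ∀ n, 1 ≤ n → Measurable (G n))
    (hGpos : ∀ n, 1 ≤ n → ∀ y, 0 < G n y)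
    (hGratio : ∀ n, 1 ≤ n → ∃ C : ℝ, ∀ y y', G n y / G n y' ≤ C) : BddPotentials G := by
  refine ⟨hGmeas, fun n hn => ?_⟩
  obtain ⟨y₀⟩ := nonempty_path K x₀ n
  obtain ⟨C, hC⟩ := hGratio n hn
  have h0 := hGpos n hn y₀
  have hC0 : 0 < C := lt_of_lt_of_le (div_pos h0 h0) (hC y₀ y₀)
  refine ⟨G n y₀ / C, C * G n y₀, by positivity, fun y => ⟨?_, ?_⟩⟩
  · have := hC y₀ y
    rw [div_le_iff₀ (hGpos n hn y)] at this
    rw [div_le_iff₀ hC0]; linarith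
  · have := hC y y₀
    rwa [div_le_iff₀ h0] at this

lemma BddPotentials.pos (hG : BddPotentials G) {n : ℕ} (hn : 1 ≤ n) (y : Path E n) : 0 < G n y := by
  obtain ⟨c, C, hc, h⟩ := hG.bounds n hn
  exact hc.trans_le (h y).1

lemma BddPotentials.bddMeas (hG : BddPotentials G) {n : ℕ} (hn : 1 ≤ n) : BddMeas (G n) := by
  obtain ⟨c, C, hc, h⟩ := hG.bounds n hn
  exact ⟨hG.measurable n hn, C, fun y => by
    rw [abs_of_pos (hG.pos hn y)]; exact (h y).2⟩

variable (G)

/-- The one-step Feynman–Kac operator `g ↦ G_n M_{n+1}(g)`. -/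
def stepOp (n : ℕ) (g : Path E (n + 1) → ℝ) (y : Path E n) : ℝ :=
  G n y * ∫ y', g y' ∂(pathKernel K n y)

/-- The common form of `Q` and `gam`: start at time `a`, collect the potentials from time `s`. -/
def feynmanKac (a s n : ℕ) (f : Path E n → ℝ) (y : Path E a) : ℝ :=
  ∫ x, f (frestrictLe (π := E) n x) * ∏ k ∈ Finset.Ico s n, G k (frestrictLe (π := E) k x)
    ∂(Kernel.traj (stepKernel K) a y)

variable {G}

lemma BddMeas.stepOp (hG : BddPotentials G) {n : ℕ} (hn : 1 ≤ n) {g : Path E (n + 1) → ℝ}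
    (hg : BddMeas g) : BddMeas (stepOp K G n g) :=
  (hG.bddMeas hn).mul (hg.kernelIntegral _)

lemma stepOp_one (n : ℕ) : stepOp K G n (fun _ => 1) = G n := by
  ext y; simp [stepOp]

/-- Markov property of the historical process: conditioning on the path up to time `n` replaces `f`
by its one-step average. -/
lemma integral_traj_mul {a n : ℕ} (h : a ≤ n) (y : Path E a) {H : Path E n → ℝ}
    {f : Path E (n + 1) → ℝ} (hH : BddMeas H) (hf : BddMeas f) :
    ∫ x, H (frestrictLe (π := E) n x) * f (frestrictLe (π := E) (n + 1) x)
        ∂(Kernel.traj (stepKernel K) a y)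
      = ∫ x, H (frestrictLe (π := E) n x) *
          ∫ y', f y' ∂(pathKernel K n (frestrictLe (π := E) n x))
        ∂(Kernel.traj (stepKernel K) a y) := by
  have e1 := Kernel.integral_traj_partialTraj' (κ := stepKernel K) (x₀ := y)
    (f := fun z x => H z * f (frestrictLe (π := E) (n + 1) x)) h
    (((hH.comp measurable_fst).mul (hf.comp ((measurable_frestrictLe (n + 1)).comp
      measurable_snd))).integrable _)
  rw [← e1, ← Kernel.traj_map_frestrictLe_apply,
    integral_map (measurable_frestrictLe n).aemeasurable]
  · refine integral_congr_ae (Eventually.of_forall fun x => ?_)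
    simp only
    rw [integral_const_mul, pathKernel, ← Kernel.traj_map_frestrictLe_apply,
      integral_map (measurable_frestrictLe _).aemeasurable hf.1.aestronglyMeasurable]
  · simp_rw [integral_const_mul]
    exact (hH.mul ((hf.comp (measurable_frestrictLe (n + 1))).kernelIntegral
      (Kernel.traj (stepKernel K) n))).1.aestronglyMeasurable

lemma bddMeas_prod_potentials (hG : BddPotentials G) {s : ℕ} (hs : 1 ≤ s) (n : ℕ) :
    BddMeas fun x : ∀ i, E i => ∏ k ∈ Finset.Ico s n, G k (frestrictLe (π := E) k x) :=
  BddMeas.prod _ fun _ hk =>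
    (hG.bddMeas (hs.trans (Finset.mem_Ico.1 hk).1)).comp (measurable_frestrictLe _)

lemma feynmanKac_succ (hG : BddPotentials G) {a s n : ℕ} (ha : a ≤ n) (hs : 1 ≤ s) (hsn : s ≤ n)
    {f : Path E (n + 1) → ℝ} (hf : BddMeas f) (y : Path E a) :
    feynmanKac K G a s (n + 1) f y = feynmanKac K G a s n (stepOp K G n f) y := by
  -- The product of potentials up to and including `G n`, seen as a function of the path up to `n`.
  -- The default value 1 is never taken on the index range.
  set H : Path E n → ℝ := fun z => ∏ k ∈ Finset.Ico s (n + 1),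
    if h : k ≤ n then G k (frestrictLe₂ (π := E) h z) else 1 with hHdef
  have hH : BddMeas H := BddMeas.prod _ fun k hk => by
    by_cases h : k ≤ n
    · simpa [h] using (hG.bddMeas (hs.trans (Finset.mem_Ico.1 hk).1)).comp
        (measurable_frestrictLe₂ h)
    · simpa [h] using BddMeas.const 1
  have hHx : ∀ x : ∀ i, E i, H (frestrictLe (π := E) n x)
      = ∏ k ∈ Finset.Ico s (n + 1), G k (frestrictLe (π := E) k x) := fun x =>
    Finset.prod_congr rfl fun k hk => by
      rw [dif_pos (Nat.lt_succ_iff.1 (Finset.mem_Ico.1 hk).2)]; rfl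
  have := integral_traj_mul K ha y hH hf
  simp_rw [hHx] at this
  unfold feynmanKac
  simp_rw [mul_comm (f _)]
  rw [this]
  refine integral_congr_ae (Eventually.of_forall fun x => ?_)
  simp only [stepOp]
  rw [Finset.prod_Ico_succ_top hsn]; ring

lemma feynmanKac_sum (hG : BddPotentials G) {a s n : ℕ} (hs : 1 ≤ s) {ι : Type*} [Fintype ι]
    {f : ι → Path E n → ℝ} (hf : ∀ i, BddMeas (f i)) (u : ι → ℝ) (y : Path E a) :
    feynmanKac K G a s n (fun z => ∑ i, u i * f i z) y = ∑ i, u i * feynmanKac K G a s n (f i) y := by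
  unfold feynmanKac
  simp_rw [Finset.sum_mul, mul_assoc]
  rw [integral_finsetSum]
  · simp_rw [integral_const_mul]
  · intro i _
    exact ((((hf i).comp (measurable_frestrictLe n)).mul
      (bddMeas_prod_potentials hG hs n)).integrable _).const_mul _

lemma gam_succ (hG : BddPotentials G) {n : ℕ} (hn : 1 ≤ n) {f : Path E (n + 1) → ℝ}
    (hf : BddMeas f) : gam K G x₀ (n + 1) f = gam K G x₀ n (stepOp K G n f) :=
  feynmanKac_succ K hG (Nat.zero_le _) le_rfl hn hf _

lemma Q_succ (hG : BddPotentials G) {p n : ℕ} (hp : 1 ≤ p) (hpn : p ≤ n) {f : Path E (n + 1) → ℝ}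
    (hf : BddMeas f) : Q K G p (n + 1) f = Q K G p n (stepOp K G n f) := by
  ext y
  exact feynmanKac_succ K hG hpn hp hpn hf _

lemma gam_sum (hG : BddPotentials G) {n : ℕ} {ι : Type*} [Fintype ι]
    {f : ι → Path E n → ℝ} (hf : ∀ i, BddMeas (f i)) (u : ι → ℝ) :
    gam K G x₀ n (fun z => ∑ i, u i * f i z) = ∑ i, u i * gam K G x₀ n (f i) :=
  feynmanKac_sum K hG le_rfl hf u _

lemma Q_sum (hG : BddPotentials G) {p n : ℕ} (hp : 1 ≤ p) {ι : Type*} [Fintype ι]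
    {f : ι → Path E n → ℝ} (hf : ∀ i, BddMeas (f i)) (u : ι → ℝ) :
    Q K G p n (fun z => ∑ i, u i * f i z) = fun y => ∑ i, u i * Q K G p n (f i) y := by
  ext y
  exact feynmanKac_sum K hG hp hf u _

lemma gam_one {f : Path E 1 → ℝ} (hf : BddMeas f) :
    gam K G x₀ 1 f = ∫ y, f y ∂(pathKernel K 0 (startPath x₀)) := by
  simp only [gam, Finset.Ico_self, Finset.prod_empty, mul_one]
  rw [pathKernel, ← Kernel.traj_map_frestrictLe_apply,
    integral_map (measurable_frestrictLe _).aemeasurable hf.1.aestronglyMeasurable]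

lemma Q_self {n : ℕ} {f : Path E n → ℝ} (hf : BddMeas f) : Q K G n n f = f := by
  ext y
  simp only [Q, Finset.Ico_self, Finset.prod_empty, mul_one]
  rw [← integral_map (φ := frestrictLe (π := E) n) (measurable_frestrictLe _).aemeasurable
    hf.1.aestronglyMeasurable, Kernel.traj_map_frestrictLe_apply, Kernel.partialTraj_self,
    Kernel.id_apply, integral_dirac' _ _ hf.1.stronglyMeasurable]

lemma BddMeas.Q (hG : BddPotentials G) {p n : ℕ} (hp : 1 ≤ p) (hpn : p ≤ n) :
    ∀ {f : Path E n → ℝ}, BddMeas f → BddMeas (Q K G p n f) := by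
  induction n, hpn using Nat.le_induction with
  | base => intro f hf; rwa [Q_self K hf]
  | succ n hn ih =>
    intro f hf
    rw [Q_succ K hG hp hn hf]
    exact ih (hf.stepOp K hG (hp.trans hn))

/-- The statement covers all functions bounded below by a positive constant, because the induction
turns the constant 1 into `G n`, then into further such functions. -/
lemma gam_pos (hG : BddPotentials G) {n : ℕ} (hn : 1 ≤ n) : ∀ {f : Path E n → ℝ}, BddMeas f →
    ∀ {c : ℝ}, 0 < c → (∀ y, c ≤ f y) → 0 < gam K G x₀ n f := by
  induction n, hn using Nat.le_induction with
  | base =>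
    intro f hf c hc h
    rw [gam_one K x₀ hf]
    have := integral_mono (integrable_const c) (hf.integrable (pathKernel K 0 (startPath x₀))) h
    simp at this
    linarith
  | succ n hn ih =>
    intro f hf c hc h
    rw [gam_succ K x₀ hG hn hf]
    obtain ⟨c', C', hc', h'⟩ := hG.bounds n hn
    refine ih (hf.stepOp K hG hn) (mul_pos hc' hc) fun y => ?_
    refine mul_le_mul (h' y).1 ?_ hc.le (hG.pos hn y).le
    simpa using integral_mono (integrable_const c) (hf.integrable (pathKernel K n y)) h

lemma gam_const_one_pos (hG : BddPotentials G) {n : ℕ} (hn : 1 ≤ n) :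
    0 < gam K G x₀ n (fun _ => 1) :=
  gam_pos K x₀ hG hn (BddMeas.const 1) one_pos fun _ => le_rfl

end Semigroup

/-! ### Empirical measures and product laws. -/

section Empirical

variable {F : Type*} [MeasurableSpace F] {N : ℕ}

lemma isProbabilityMeasure_empirical (hN : 1 ≤ N) (z : Fin N → F) :
    IsProbabilityMeasure (empirical z) := by
  refine ⟨?_⟩
  simp only [empirical, Measure.smul_apply, Measure.finsetSum_apply, measure_univ, smul_eq_mul]
  simp only [Finset.sum_const, Finset.card_univ, Fintype.card_fin, nsmul_eq_mul, mul_one]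
  exact ENNReal.inv_mul_cancel (by simp; omega) (by simp)

lemma integral_empirical (z : Fin N → F) {f : F → ℝ} (hf : Measurable f) :
    ∫ y, f y ∂(empirical z) = avg z f := by
  rw [empirical, integral_smul_measure, integral_finsetSum_measure]
  · simp [avg, integral_dirac' _ _ hf.stronglyMeasurable]
  · intro i _
    exact (integrable_dirac' hf.stronglyMeasurable (by simp))

lemma lintegral_empirical (z : Fin N → F) {f : F → ℝ≥0∞} (hf : Measurable f) :
    ∫⁻ y, f y ∂(empirical z) = (N : ℝ≥0∞)⁻¹ * ∑ i, f (z i) := by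
  rw [empirical, lintegral_smul_measure, lintegral_finsetSum_measure]
  simp [lintegral_dirac' _ hf]

lemma abs_avg_le {β : Type*} (hN : 1 ≤ N) (z : Fin N → β) {f : β → ℝ} {B : ℝ} (hB : ∀ y, |f y| ≤ B) :
    |avg z f| ≤ B := by
  have hN' : (0 : ℝ) < N := by exact_mod_cast hN
  rw [avg, abs_mul, abs_inv, abs_of_pos hN', inv_mul_le_iff₀ hN']
  refine (Finset.abs_sum_le_sum_abs _ _).trans ((Finset.sum_le_sum fun i _ => hB (z i)).trans ?_)
  simp

lemma le_avg {β : Type*} (hN : 1 ≤ N) (z : Fin N → β) {f : β → ℝ} {B : ℝ} (hB : ∀ y, B ≤ f y) :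
    B ≤ avg z f := by
  have hN' : (0 : ℝ) < N := by exact_mod_cast hN
  rw [avg, le_inv_mul_iff₀ hN']
  refine le_trans ?_ (Finset.sum_le_sum fun i _ => hB (z i))
  simp

/-- Measurability is checked on boxes, a generating π-system on which the product measure is a
finite product of measurable functions. -/
lemma measurable_measure_pi {α : Type*} [MeasurableSpace α] {μ : α → Measure F}
    [∀ a, IsProbabilityMeasure (μ a)] (hμ : Measurable μ) :
    Measurable fun a => Measure.pi fun _ : Fin N => μ a := by
  refine Measurable.measure_of_isPiSystem_of_isProbabilityMeasure generateFrom_pi.symm isPiSystem_pi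
    ?_
  rintro _ ⟨s, hs, rfl⟩
  simp_rw [Measure.pi_pi]
  exact Finset.measurable_prod _ fun i _ =>
    (Measure.measurable_coe (hs i (Set.mem_univ i))).comp hμ

end Empirical

/-! ### The map `Φ` at an empirical measure. -/

section Selection

variable {E : ℕ → Type u} [∀ n, MeasurableSpace (E n)]
  (K : (n : ℕ) → Kernel (E n) (E (n + 1))) [∀ n, IsMarkovKernel (K n)]
  {G : (n : ℕ) → Path E n → ℝ} {n N : ℕ}

omit [∀ n, IsMarkovKernel (K n)] in
lemma Phi_empirical_apply (hG : BddPotentials G) (hn : 1 ≤ n)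
    (z : Fin N → Path E n) {B : Set (Path E (n + 1))} (hB : MeasurableSet B) :
    Phi K G n (empirical z) B
      = ((N : ℝ≥0∞)⁻¹ * ∑ i, ENNReal.ofReal (G n (z i)))⁻¹ *
        ((N : ℝ≥0∞)⁻¹ * ∑ i, ENNReal.ofReal (G n (z i)) * pathKernel K n (z i) B) := by
  have hm : Measurable fun y => ENNReal.ofReal (G n y) := (hG.measurable n hn).ennreal_ofReal
  have hk : Measurable fun y => pathKernel K n y B := (pathKernel K n).measurable_coe hB
  rw [Phi, Measure.smul_apply, Measure.bind_apply hB (pathKernel K n).aemeasurable,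
    lintegral_withDensity_eq_lintegral_mul _ hm hk, lintegral_empirical z hm,
    lintegral_empirical z (hm.mul hk)]
  simp

omit [∀ n, IsMarkovKernel (K n)] in
lemma measurable_Phi_empirical (hG : BddPotentials G) (hn : 1 ≤ n) :
    Measurable fun z : Fin N → Path E n => Phi K G n (empirical z) := by
  have hm : Measurable fun y => ENNReal.ofReal (G n y) := (hG.measurable n hn).ennreal_ofReal
  refine Measure.measurable_of_measurable_coe _ fun B hB => ?_
  have hk : Measurable fun y => pathKernel K n y B := (pathKernel K n).measurable_coe hB
  simp_rw [Phi_empirical_apply K hG hn _ hB]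
  refine Measurable.mul (Measurable.inv (Measurable.const_mul ?_ _)) (Measurable.const_mul ?_ _)
  · exact Finset.measurable_sum _ fun i _ => hm.comp (measurable_pi_apply i)
  · exact Finset.measurable_sum _ fun i _ => (hm.mul hk).comp (measurable_pi_apply i)

lemma lintegral_potential_empirical (hG : BddPotentials G) (hn : 1 ≤ n) (z : Fin N → Path E n) :
    ∫⁻ y, ENNReal.ofReal (G n y) ∂(empirical z) = ENNReal.ofReal (avg z (G n)) := by
  have hm : Measurable fun y => ENNReal.ofReal (G n y) := (hG.measurable n hn).ennreal_ofReal
  rcases Nat.eq_zero_or_pos N with rfl | hN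
  · simp [lintegral_empirical z hm, avg]
  · rw [lintegral_empirical z hm, avg, ENNReal.ofReal_mul (by positivity),
      ENNReal.ofReal_sum_of_nonneg fun i _ => (hG.pos hn _).le,
      ENNReal.ofReal_inv_of_pos (by exact_mod_cast hN), ENNReal.ofReal_natCast]

lemma avg_potential_pos (hG : BddPotentials G) (hn : 1 ≤ n) (hN : 1 ≤ N) (z : Fin N → Path E n) :
    0 < avg z (G n) := by
  obtain ⟨c, C, hc, h⟩ := hG.bounds n hn
  exact hc.trans_le (le_avg hN z fun y => (h y).1)

lemma isProbabilityMeasure_Phi (hG : BddPotentials G) (hn : 1 ≤ n) (hN : 1 ≤ N)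
    (z : Fin N → Path E n) : IsProbabilityMeasure (Phi K G n (empirical z)) := by
  have hm : Measurable fun y => ENNReal.ofReal (G n y) := (hG.measurable n hn).ennreal_ofReal
  refine ⟨?_⟩
  rw [Phi_empirical_apply K hG hn z MeasurableSet.univ]
  simp only [measure_univ, mul_one]
  rw [← lintegral_empirical z hm, lintegral_potential_empirical hG hn]
  exact ENNReal.inv_mul_cancel (by simpa using avg_potential_pos hG hn hN z) (by simp)

lemma integral_Phi_empirical (hG : BddPotentials G) (hn : 1 ≤ n) (hN : 1 ≤ N)
    (z : Fin N → Path E n) {g : Path E (n + 1) → ℝ} (hg : BddMeas g) :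
    ∫ y, g y ∂(Phi K G n (empirical z)) = avg z (stepOp K G n g) / avg z (G n) := by
  have hm : Measurable fun y => ENNReal.ofReal (G n y) := (hG.measurable n hn).ennreal_ofReal
  have e : Phi K G n (empirical z) = (ENNReal.ofReal (avg z (G n)))⁻¹ •
      ((N : ℝ≥0∞)⁻¹ • ∑ i, ENNReal.ofReal (G n (z i)) • pathKernel K n (z i)) := by
    ext B hB
    rw [Phi_empirical_apply K hG hn z hB, ← lintegral_empirical z hm,
      lintegral_potential_empirical hG hn]
    simp
  rw [e, integral_smul_measure, integral_smul_measure, integral_finsetSum_measure]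
  · have hp := avg_potential_pos hG hn hN z
    simp only [integral_smul_measure, ENNReal.toReal_inv, ENNReal.toReal_ofReal hp.le,
      ENNReal.toReal_natCast, smul_eq_mul, ENNReal.toReal_ofReal (hG.pos hn _).le]
    rw [div_eq_inv_mul]; rfl
  · intro i _
    exact (hg.integrable _).smul_measure (by simp)

end Selection

/-! ### Conditioning on the past of the particle system. -/

section Transition

variable {E : ℕ → Type u} [∀ n, MeasurableSpace (E n)]
  {K : (n : ℕ) → Kernel (E n) (E (n + 1))} [∀ n, IsMarkovKernel (K n)]
  {G : (n : ℕ) → Path E n → ℝ} {x₀ : E 0} {n N : ℕ}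
  {Ω : Type v} [MeasurableSpace Ω] {P : Measure Ω} [IsProbabilityMeasure P]
  {ξ : (p : ℕ) → Ω → Fin N → Path E p}

/-- The configurations of the particle system between times `1` and `n`. -/
def past (ξ : (p : ℕ) → Ω → Fin N → Path E p) (n : ℕ) (ω : Ω) (q : Finset.Icc 1 n) :
    Fin N → Path E q := ξ q ω

omit [∀ n, IsMarkovKernel (K n)] [IsProbabilityMeasure P] in
lemma IsParticleSystem.measurable_past (hξ : IsParticleSystem K G x₀ P N ξ) (n : ℕ) :
    Measurable (past ξ n) :=
  measurable_pi_lambda _ fun q => hξ.measurable q (Finset.mem_Icc.1 q.2).1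

variable (K) in
/-- The transition of the particle system from the configurations up to time `n` to the one at time
`n + 1`. -/
def transition (hG : BddPotentials G) (hn : 1 ≤ n) (hN : 1 ≤ N) :
    Kernel ((q : Finset.Icc 1 n) → Fin N → Path E q) (Fin N → Path E (n + 1)) where
  toFun y := Measure.pi fun _ : Fin N =>
    Phi K G n (empirical (y ⟨n, Finset.mem_Icc.2 ⟨hn, le_rfl⟩⟩))
  measurable' :=
    haveI := fun z : Fin N → Path E n => isProbabilityMeasure_Phi K hG hn hN z
    (measurable_measure_pi (measurable_Phi_empirical K hG hn)).comp (measurable_pi_apply _)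

instance (hG : BddPotentials G) (hn : 1 ≤ n) (hN : 1 ≤ N) :
    IsMarkovKernel (transition K hG hn hN) :=
  ⟨fun y => by
    have := isProbabilityMeasure_Phi K hG hn hN (y ⟨n, Finset.mem_Icc.2 ⟨hn, le_rfl⟩⟩)
    change IsProbabilityMeasure (Measure.pi _)
    infer_instance⟩

/-- Rectangles determine the joint law, and on rectangles the identity is the defining property
`step`. -/
lemma IsParticleSystem.map_past_prodMk (hξ : IsParticleSystem K G x₀ P N ξ)
    (hG : BddPotentials G) (hn : 1 ≤ n) (hN : 1 ≤ N) :
    P.map (fun ω => (past ξ n ω, ξ (n + 1) ω)) = (P.map (past ξ n)) ⊗ₘ transition K hG hn hN := by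
  have hp := hξ.measurable_past n
  have hx := hξ.measurable (n + 1) (by omega)
  have : IsProbabilityMeasure (P.map (past ξ n)) := Measure.isProbabilityMeasure_map hp.aemeasurable
  refine Measure.ext_prod fun {A B} hA hB => ?_
  rw [Measure.map_apply (hp.prodMk hx) (hA.prod hB), Measure.compProd_apply_prod hA hB,
    setLIntegral_map hA ((transition K hG hn hN).measurable_coe hB) hp]
  exact hξ.step n hn A hA B hB

/-- Integration of a function of a past-measurable variable and of the next configuration. -/
lemma IsParticleSystem.integral_next (hξ : IsParticleSystem K G x₀ P N ξ)
    (hG : BddPotentials G) (hn : 1 ≤ n) (hN : 1 ≤ N) {β : Type*} [MeasurableSpace β]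
    [StandardBorelSpace β] [Nonempty β] {U : Ω → β}
    (hU : Measurable[MeasurableSpace.comap (past ξ n) inferInstance] U)
    {V : Type*} [NormedAddCommGroup V] [NormedSpace ℝ V]
    {H : β × (Fin N → Path E (n + 1)) → V} (hH : StronglyMeasurable H)
    (hi : Integrable (fun ω => H (U ω, ξ (n + 1) ω)) P) :
    Integrable (fun ω => ∫ z, H (U ω, z)
        ∂(Measure.pi fun _ : Fin N => Phi K G n (empirical (ξ n ω)))) P ∧
      ∫ ω, H (U ω, ξ (n + 1) ω) ∂P = ∫ ω, ∫ z, H (U ω, z)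
        ∂(Measure.pi fun _ : Fin N => Phi K G n (empirical (ξ n ω))) ∂P := by
  have hp := hξ.measurable_past n
  have hx := hξ.measurable (n + 1) (by omega)
  have : IsProbabilityMeasure (P.map (past ξ n)) := Measure.isProbabilityMeasure_map hp.aemeasurable
  -- Doob–Dynkin factorisation through the past, for which `β` is required to be standard Borel.
  obtain ⟨φ, hφ, rfl⟩ := hU.exists_eq_measurable_comp
  have hmap := hξ.map_past_prodMk hG hn hN
  have hH' : StronglyMeasurable fun q : ((q : Finset.Icc 1 n) → Fin N → Path E q) ×
      (Fin N → Path E (n + 1)) => H (φ q.1, q.2) :=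
    hH.comp_measurable ((hφ.comp measurable_fst).prodMk measurable_snd)
  have hi' : Integrable (fun q : ((q : Finset.Icc 1 n) → Fin N → Path E q) ×
      (Fin N → Path E (n + 1)) => H (φ q.1, q.2)) ((P.map (past ξ n)) ⊗ₘ transition K hG hn hN) := by
    rw [← hmap, integrable_map_measure hH'.aestronglyMeasurable (hp.prodMk hx).aemeasurable]
    exact hi
  have e1 := Measure.integral_compProd hi'
  have i1 : Integrable (fun y => ∫ z, H (φ y, z) ∂(transition K hG hn hN y))
      (P.map (past ξ n)) := by
    -- The law of the past is viewed as a constant kernel on `Unit`, to use the kernel form of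
    -- Fubini integrability.
    simpa using Integrable.integral_compProd (κ := Kernel.const Unit (P.map (past ξ n)))
      (η := Kernel.prodMkLeft Unit (transition K hG hn hN)) (a := ()) hi'
  rw [← hmap, integral_map (hp.prodMk hx).aemeasurable hH'.aestronglyMeasurable,
    integral_map hp.aemeasurable i1.aestronglyMeasurable] at e1
  exact ⟨(integrable_map_measure i1.aestronglyMeasurable hp.aemeasurable).1 i1, e1⟩

end Transition

/-! ### Recursion for the particle measures with `N` fixed. -/

section Single

variable {E : ℕ → Type u} [∀ n, MeasurableSpace (E n)]
  {K : (n : ℕ) → Kernel (E n) (E (n + 1))} [∀ n, IsMarkovKernel (K n)]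
  {G : (n : ℕ) → Path E n → ℝ} {x₀ : E 0} {n N : ℕ}
  {Ω : Type v} {ξ : (p : ℕ) → Ω → Fin N → Path E p}

lemma etaN_eq_avg {f : Path E n → ℝ} (hf : Measurable f) (ω : Ω) :
    etaN ξ n f ω = avg (ξ n ω) f := integral_empirical _ hf

lemma gamN_sum {ι : Type*} [Fintype ι] {f : ι → Path E n → ℝ} (hf : ∀ i, BddMeas (f i))
    (u : ι → ℝ) (ω : Ω) :
    gamN G ξ n (fun y => ∑ i, u i * f i y) ω = ∑ i, u i * gamN G ξ n (f i) ω := by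
  have h : etaN ξ n (fun y => ∑ i, u i * f i y) ω = ∑ i, u i * etaN ξ n (f i) ω := by
    rw [etaN_eq_avg (Finset.measurable_sum _ fun i _ => (hf i).1.const_mul _)]
    simp_rw [fun i => etaN_eq_avg (ξ := ξ) (hf i).1 ω, avg, Finset.mul_sum]
    rw [Finset.sum_comm]
    refine Finset.sum_congr rfl fun i _ => Finset.sum_congr rfl fun j _ => by ring
  simp only [gamN, h, Finset.sum_mul, mul_assoc]

lemma gamN_succ (hn : 1 ≤ n) {f : Path E (n + 1) → ℝ} (hf : Measurable f) (ω : Ω) :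
    gamN G ξ (n + 1) f ω = gamN G ξ n (G n) ω * avg (ξ (n + 1) ω) f := by
  simp only [gamN, Finset.prod_Ico_succ_top hn, etaN_eq_avg hf]
  ring

lemma gamN_one {f : Path E 1 → ℝ} (hf : Measurable f) (ω : Ω) :
    gamN G ξ 1 f ω = avg (ξ 1 ω) f := by
  simp [gamN, etaN_eq_avg hf]

/-- The normalisation of `Φ` cancels against the factor `η_n^N(G_n)` contained in `γ_n^N(G_n)`. This
cancellation is what makes the recursion for `γ^N` linear. -/
lemma gamN_mul_integral_Phi (hG : BddPotentials G) (hn : 1 ≤ n) (hN : 1 ≤ N)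
    {g : Path E (n + 1) → ℝ} (hg : BddMeas g) (ω : Ω) :
    gamN G ξ n (G n) ω * ∫ y, g y ∂(Phi K G n (empirical (ξ n ω)))
      = gamN G ξ n (stepOp K G n g) ω := by
  rw [integral_Phi_empirical K hG hn hN _ hg, gamN, gamN, etaN_eq_avg (hG.measurable n hn),
    etaN_eq_avg (hg.stepOp K hG hn).1]
  have := (avg_potential_pos hG hn hN (ξ n ω)).ne'
  field_simp

lemma gamN_pos (hG : BddPotentials G) (hN : 1 ≤ N) (ω : Ω) :
    0 < gamN G ξ n (fun _ => 1) ω := by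
  rw [gamN, etaN_eq_avg measurable_const]
  refine mul_pos (one_pos.trans_le (le_avg hN _ fun _ => le_rfl))
    (Finset.prod_pos fun p hp => ?_)
  rw [etaN_eq_avg (hG.measurable p (Finset.mem_Ico.1 hp).1)]
  exact avg_potential_pos hG (Finset.mem_Ico.1 hp).1 hN _

lemma gamN_eq_mul_etaN {f : Path E n → ℝ} (hN : 1 ≤ N) (ω : Ω) :
    gamN G ξ n f ω = etaN ξ n f ω * gamN G ξ n (fun _ => 1) ω := by
  have := isProbabilityMeasure_empirical hN (ξ n ω)
  simp [gamN, etaN]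

/-- The recursion satisfied by the fluctuation fields `W_n^{γ,N}`: a local sampling error plus the
transported fluctuation. -/
lemma fluct_gamma_succ (hG : BddPotentials G) (hn : 1 ≤ n) (hN : 1 ≤ N)
    {g : Path E (n + 1) → ℝ} (hg : BddMeas g) (ω : Ω) :
    fluct K G x₀ ξ (n + 1) .gamma g ω
      = fluct K G x₀ ξ n .gamma (stepOp K G n g) ω + gamN G ξ n (G n) ω *
        (Real.sqrt N * (avg (ξ (n + 1) ω) g
          - ∫ y, g y ∂(Phi K G n (empirical (ξ n ω))))) := by
  have h := gamN_mul_integral_Phi (K := K) (ξ := ξ) hG hn hN hg ω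
  simp only [fluct]
  rw [gamN_succ hn hg.1, gam_succ K x₀ hG hn hg, ← h]
  ring

lemma fluct_gamma_one {g : Path E 1 → ℝ} (hg : BddMeas g) (ω : Ω) :
    fluct K G x₀ ξ 1 .gamma g ω = Real.sqrt N * (avg (ξ 1 ω) g
          - ∫ y, g y ∂(pathKernel K 0 (startPath x₀))) := by
  simp only [fluct]
  rw [gamN_one hg.1, gam_one K x₀ hg]

lemma fluct_gamma_sum (hG : BddPotentials G) {ι : Type*} [Fintype ι] {f : ι → Path E n → ℝ}
    (hf : ∀ i, BddMeas (f i)) (u : ι → ℝ) (ω : Ω) :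
    fluct K G x₀ ξ n .gamma (fun y => ∑ i, u i * f i y) ω
      = ∑ i, u i * fluct K G x₀ ξ n .gamma (f i) ω := by
  simp only [fluct]
  rw [gamN_sum hf, gam_sum K x₀ hG hf, ← Finset.sum_sub_distrib, Finset.mul_sum]
  exact Finset.sum_congr rfl fun i _ => by ring

lemma measurable_etaN [MeasurableSpace Ω] {f : Path E n → ℝ} (hf : Measurable f)
    (hξ : Measurable (ξ n)) : Measurable (etaN ξ n f) := by
  rw [funext fun ω => etaN_eq_avg (ξ := ξ) hf ω]
  exact (measurable_avg hf).comp hξ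

lemma measurable_gamN [MeasurableSpace Ω] (hG : BddPotentials G) (hn : 1 ≤ n)
    (hξ : ∀ p ∈ Finset.Icc 1 n, Measurable (ξ p)) {f : Path E n → ℝ} (hf : Measurable f) :
    Measurable (gamN G ξ n f) := by
  refine (measurable_etaN hf (hξ n (by simp [hn]))).mul
    (Finset.measurable_prod _ fun p hp => ?_)
  have := Finset.mem_Ico.1 hp
  exact measurable_etaN (hG.measurable p this.1) (hξ p (Finset.mem_Icc.2 ⟨this.1, this.2.le⟩))

lemma measurable_fluct [MeasurableSpace Ω] (hG : BddPotentials G) (hn : 1 ≤ n)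
    (hξ : ∀ p ∈ Finset.Icc 1 n, Measurable (ξ p)) {f : Path E n → ℝ} (hf : Measurable f)
    (ν : Kind) : Measurable (fluct K G x₀ ξ n ν f) := by
  cases ν
  · exact ((measurable_gamN hG hn hξ hf).sub_const _).const_mul _
  · exact ((measurable_etaN hf (hξ n (by simp [hn]))).sub_const _).const_mul _

lemma measurable_comap_past (p : ℕ) (hp : p ∈ Finset.Icc 1 n) :
    Measurable[MeasurableSpace.comap (past ξ n) inferInstance] (ξ p) := by
  have : ξ p = (fun y : (q : Finset.Icc 1 n) → Fin N → Path E q => y ⟨p, hp⟩) ∘ past ξ n := rfl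
  rw [this]
  exact (measurable_pi_apply _).comp (comap_measurable _)

lemma measurable_integral_Phi [MeasurableSpace Ω] (hG : BddPotentials G) (hn : 1 ≤ n)
    (hN : 1 ≤ N) (hξ : Measurable (ξ n)) {g : Path E (n + 1) → ℝ} (hg : BddMeas g) :
    Measurable fun ω => ∫ y, g y ∂(Phi K G n (empirical (ξ n ω))) := by
  simp_rw [integral_Phi_empirical K hG hn hN _ hg]
  exact ((measurable_avg (hg.stepOp K hG hn).1).comp hξ).div
    ((measurable_avg (hG.measurable n hn)).comp hξ)

end Single

/-! ### Bounds and moments uniform in the number of particles. -/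

section Family

variable {E : ℕ → Type u} [∀ n, MeasurableSpace (E n)]
  {K : (n : ℕ) → Kernel (E n) (E (n + 1))} [∀ n, IsMarkovKernel (K n)]
  {G : (n : ℕ) → Path E n → ℝ} {x₀ : E 0} {n : ℕ} {Ω : ℕ → Type v}
  {ξ : (N : ℕ) → (p : ℕ) → Ω N → Fin N → Path E p}

lemma exists_abs_gamN_le (hG : BddPotentials G) {f : Path E n → ℝ} (hf : BddMeas f) :
    ∃ C, 0 < C ∧ ∀ N, 1 ≤ N → ∀ ω : Ω N, |gamN G (ξ N) n f ω| ≤ C := by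
  obtain ⟨B, hB0, hB⟩ := hf.exists_pos_bound
  have : ∀ p ∈ Finset.Ico 1 n, ∃ C, 0 < C ∧ ∀ y, |G p y| ≤ C := fun p hp =>
    (hG.bddMeas (Finset.mem_Ico.1 hp).1).exists_pos_bound
  choose! C hC using this
  refine ⟨B * ∏ p ∈ Finset.Ico 1 n, C p,
    mul_pos hB0 (Finset.prod_pos fun p hp => (hC p hp).1), fun N hN ω => ?_⟩
  rw [gamN, abs_mul, Finset.abs_prod, etaN_eq_avg hf.1]
  refine mul_le_mul (abs_avg_le hN _ hB) (Finset.prod_le_prod (fun _ _ => abs_nonneg _)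
    fun p hp => ?_) (Finset.prod_nonneg fun _ _ => abs_nonneg _) hB0.le
  rw [etaN_eq_avg (hG.measurable p (Finset.mem_Ico.1 hp).1)]
  exact abs_avg_le hN _ (hC p hp).2

lemma exists_le_gamN_one (hG : BddPotentials G) (n : ℕ) :
    ∃ c, 0 < c ∧ ∀ N, 1 ≤ N → ∀ ω : Ω N, c ≤ gamN G (ξ N) n (fun _ => 1) ω := by
  have : ∀ p ∈ Finset.Ico 1 n, ∃ c, 0 < c ∧ ∀ y, c ≤ G p y := fun p hp => by
    obtain ⟨c, C, hc, h⟩ := hG.bounds p (Finset.mem_Ico.1 hp).1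
    exact ⟨c, hc, fun y => (h y).1⟩
  choose! c hc using this
  refine ⟨1 * ∏ p ∈ Finset.Ico 1 n, c p,
    mul_pos one_pos (Finset.prod_pos fun p hp => (hc p hp).1), fun N hN ω => ?_⟩
  rw [gamN, etaN_eq_avg measurable_const]
  have h1 : (1 : ℝ) ≤ avg (ξ N n ω) fun _ => 1 := le_avg hN _ fun _ => le_rfl
  refine mul_le_mul h1 (Finset.prod_le_prod (fun p hp => (hc p hp).1.le)
    fun p hp => ?_) (Finset.prod_nonneg fun p hp => (hc p hp).1.le) (zero_le_one.trans h1)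
  rw [etaN_eq_avg (hG.measurable p (Finset.mem_Ico.1 hp).1)]
  exact le_avg hN _ (hc p hp).2

/-- The bound grows with `N`; it serves only for integrability at fixed `N`. -/
lemma exists_abs_fluct_gamma_le (hG : BddPotentials G) {f : Path E n → ℝ} (hf : BddMeas f) {N : ℕ}
    (hN : 1 ≤ N) : ∃ C, ∀ ω : Ω N, |fluct K G x₀ (ξ N) n .gamma f ω| ≤ C := by
  obtain ⟨C, -, hC⟩ := exists_abs_gamN_le (ξ := ξ) hG hf
  refine ⟨Real.sqrt N * (C + |gam K G x₀ n f|), fun ω => ?_⟩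
  simp only [fluct]
  rw [abs_mul, abs_of_nonneg (Real.sqrt_nonneg _)]
  gcongr
  exact (abs_sub _ _).trans (add_le_add (hC N hN ω) le_rfl)

variable [∀ N, MeasurableSpace (Ω N)] {P : (N : ℕ) → Measure (Ω N)}
  [∀ N, IsProbabilityMeasure (P N)]

omit [∀ N, IsProbabilityMeasure (P N)] in
lemma bddMeas_fluct_gamma (hG : BddPotentials G) (hn : 1 ≤ n)
    (hξ : ∀ N, 1 ≤ N → IsParticleSystem K G x₀ (P N) N (ξ N))
    {f : Path E n → ℝ} (hf : BddMeas f) {N : ℕ} (hN : 1 ≤ N) :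
    BddMeas fun ω => fluct K G x₀ (ξ N) n .gamma f ω :=
  ⟨measurable_fluct hG hn (fun p hp => (hξ N hN).measurable p (Finset.mem_Icc.1 hp).1) hf.1 _,
    exists_abs_fluct_gamma_le hG hf hN⟩

lemma BddMeas.integrable_exp {F : Type*} [MeasurableSpace F] {h : F → ℝ} (hh : BddMeas h)
    (μ : Measure F) [IsFiniteMeasure μ] : Integrable (fun x => Real.exp (h x)) μ := by
  obtain ⟨m, C, hC⟩ := hh
  refine BddMeas.integrable ⟨m.exp, Real.exp C, fun x => ?_⟩ μ
  rw [abs_of_pos (Real.exp_pos _)]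
  exact Real.exp_le_exp.2 ((le_abs_self _).trans (hC x))

/-- Uniform bound on exponential moments of the fluctuation fields. -/
lemma exists_integral_exp_fluct_le (hG : BddPotentials G) (hn : 1 ≤ n)
    (hξ : ∀ N, 1 ≤ N → IsParticleSystem K G x₀ (P N) N (ξ N)) :
    ∀ {g : Path E n → ℝ}, BddMeas g → ∃ C, ∀ N, 1 ≤ N →
      ∫ ω, Real.exp (fluct K G x₀ (ξ N) n .gamma g ω) ∂(P N) ≤ C := by
  induction n, hn using Nat.le_induction with
  | base =>
    intro g hg
    obtain ⟨B, hB⟩ := hg.2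
    refine ⟨Real.exp ((1 * (2 * B)) ^ 2 / 2), fun N hN => ?_⟩
    have h := integral_pi_exp_le (μ := pathKernel K 0 (startPath x₀)) (θ := 1) hg.1 hB
      (le_of_eq abs_one) hN
    have hm : Measurable fun z : Fin N → Path E 1 => avg z g := measurable_avg hg.1
    rw [← (hξ N hN).init, integral_map ((hξ N hN).measurable 1 le_rfl).aemeasurable
      (by fun_prop)] at h
    simpa only [fluct_gamma_one hg, one_mul] using h
  | succ n hn ih =>
    intro g hg
    obtain ⟨B, hB⟩ := hg.2
    obtain ⟨C, hC⟩ := ih (hg.stepOp K hG hn)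
    obtain ⟨T, -, hT⟩ := exists_abs_gamN_le (ξ := ξ) hG (hG.bddMeas hn)
    set D := Real.exp ((T * (2 * B)) ^ 2 / 2) with hD
    refine ⟨C * D, fun N hN => ?_⟩
    have hp := hξ N hN
    have hm : Measurable fun z : Fin N → Path E (n + 1) => avg z g := measurable_avg hg.1
    -- The three past-measurable quantities in the recursion are packed into `ℝ³`, a standard Borel
    -- space as `integral_next` demands.
    set U : Ω N → ℝ × ℝ × ℝ := fun ω => (fluct K G x₀ (ξ N) n .gamma (stepOp K G n g) ω,
      gamN G (ξ N) n (G n) ω, ∫ y, g y ∂(Phi K G n (empirical (ξ N n ω)))) with hUdef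
    have hU : Measurable[MeasurableSpace.comap (past (ξ N) n) inferInstance] U := by
      let _ : MeasurableSpace (Ω N) := MeasurableSpace.comap (past (ξ N) n) inferInstance
      have hc := measurable_comap_past (ξ := ξ N) (n := n)
      exact (measurable_fluct hG hn hc (hg.stepOp K hG hn).1 _).prodMk
        ((measurable_gamN hG hn hc (hG.measurable n hn)).prodMk
          (measurable_integral_Phi hG hn hN (hc n (by simp [hn])) hg))
    set H : (ℝ × ℝ × ℝ) × (Fin N → Path E (n + 1)) → ℝ := fun q =>
      Real.exp (q.1.1 + q.1.2.1 * (Real.sqrt N * (avg q.2 g - q.1.2.2))) with hHdef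
    have hH : StronglyMeasurable H := by
      have hm' : Measurable fun q : (ℝ × ℝ × ℝ) × (Fin N → Path E (n + 1)) => avg q.2 g :=
        hm.comp measurable_snd
      refine Measurable.stronglyMeasurable ?_
      simp only [hHdef]
      fun_prop
    have e0 : ∀ ω, H (U ω, ξ N (n + 1) ω) = Real.exp (fluct K G x₀ (ξ N) (n + 1) .gamma g ω) :=
      fun ω => by simp only [hHdef, hUdef, fluct_gamma_succ hG hn hN hg]
    obtain ⟨i1, e1⟩ := hp.integral_next hG hn hN hU hH (by
      simp_rw [e0]; exact (bddMeas_fluct_gamma hG (by omega) hξ hg hN).integrable_exp _)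
    simp_rw [e0] at e1
    rw [e1]
    have iE := (bddMeas_fluct_gamma hG hn hξ (hg.stepOp K hG hn) hN).integrable_exp (P N)
    -- Given the past, the old exponential factors out and Hoeffding bounds the new one by the
    -- deterministic `D`, since `|γ_n^N(G_n)| ≤ T`.
    refine (integral_mono i1 (iE.mul_const D) fun ω => ?_).trans ?_
    · have := isProbabilityMeasure_Phi K hG hn hN (ξ N n ω)
      simp only [hHdef, hUdef, Real.exp_add]
      rw [integral_const_mul]
      exact mul_le_mul_of_nonneg_left (integral_pi_exp_le hg.1 hB (hT N hN ω) hN)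
        (Real.exp_pos _).le
    · rw [integral_mul_const]
      exact mul_le_mul_of_nonneg_right (hC N hN) (Real.exp_pos _).le

lemma abs_pow_le_factorial_mul_exp (x : ℝ) (k : ℕ) :
    |x| ^ k ≤ k.factorial * (Real.exp x + Real.exp (-x)) := by
  have h := Real.pow_div_factorial_le_exp |x| (abs_nonneg x) k
  rw [div_le_iff₀ (by positivity), mul_comm] at h
  refine h.trans (mul_le_mul_of_nonneg_left ?_ (by positivity))
  rcases abs_cases x with ⟨e, -⟩ | ⟨e, -⟩ <;> rw [e]
  · linarith [Real.exp_pos (-x)]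
  · linarith [Real.exp_pos x]

/-- Uniform bound on all absolute moments of the fluctuation fields. -/
lemma exists_integral_abs_fluct_pow_le (hG : BddPotentials G) (hn : 1 ≤ n)
    (hξ : ∀ N, 1 ≤ N → IsParticleSystem K G x₀ (P N) N (ξ N))
    {g : Path E n → ℝ} (hg : BddMeas g) (k : ℕ) : ∃ C, ∀ N, 1 ≤ N →
      ∫ ω, |fluct K G x₀ (ξ N) n .gamma g ω| ^ k ∂(P N) ≤ C := by
  -- `-g` is written as a one-term linear combination so that `fluct_gamma_sum` gives the sign
  -- change.
  have hg' : BddMeas fun y => ∑ i : Unit, (fun _ => (-1 : ℝ)) i * g y := by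
    simpa using (BddMeas.const (-1)).mul hg
  obtain ⟨C, hC⟩ := exists_integral_exp_fluct_le hG hn hξ hg
  obtain ⟨C', hC'⟩ := exists_integral_exp_fluct_le hG hn hξ hg'
  refine ⟨k.factorial * (C + C'), fun N hN => ?_⟩
  have hb := bddMeas_fluct_gamma hG hn hξ hg hN
  have hb' := bddMeas_fluct_gamma hG hn hξ hg' hN
  have h' := hC' N hN
  have e : ∀ ω, fluct K G x₀ (ξ N) n .gamma (fun y => ∑ i : Unit, (fun _ => (-1 : ℝ)) i * g y) ω
      = -fluct K G x₀ (ξ N) n .gamma g ω := fun ω => by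
    rw [fluct_gamma_sum hG (f := fun _ : Unit => g) fun _ => hg]; simp
  have i1 := hb.integrable_exp (P N)
  have i2 := hb'.integrable_exp (P N)
  simp_rw [e] at h' i2
  calc _ ≤ ∫ ω, k.factorial * (Real.exp (fluct K G x₀ (ξ N) n .gamma g ω)
          + Real.exp (-fluct K G x₀ (ξ N) n .gamma g ω)) ∂(P N) :=
        integral_mono_of_nonneg (Eventually.of_forall fun ω => by positivity)
          ((i1.add i2).const_mul _)
          (Eventually.of_forall fun ω => abs_pow_le_factorial_mul_exp _ k)
    _ ≤ _ := by
        rw [integral_const_mul, integral_add i1 i2]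
        exact mul_le_mul_of_nonneg_left (add_le_add (hC N hN) h') (by positivity)

end Family

/-! ### The asymptotic variance and its recursion. -/

section Variance

variable {E : ℕ → Type u} [∀ n, MeasurableSpace (E n)]
  (K : (n : ℕ) → Kernel (E n) (E (n + 1))) [∀ n, IsMarkovKernel (K n)]
  (G : (n : ℕ) → Path E n → ℝ) (x₀ : E 0)

/-- The variance `γ_p(1)² η_p((h - η_p(h))²)` of `γ_p(1) W_p(h)`. -/
def localVar (p : ℕ) (h : Path E p → ℝ) : ℝ :=
  gam K G x₀ p (fun _ => 1) * gam K G x₀ p (fun y => h y ^ 2) - gam K G x₀ p h ^ 2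

/-- The variance of `W_n^γ(g)`. -/
def asympVar (n : ℕ) (g : Path E n → ℝ) : ℝ :=
  ∑ p ∈ Finset.Icc 1 n, localVar K G x₀ p (Q K G p n g)

variable {G}

lemma asympVar_one {g : Path E 1 → ℝ} (hg : BddMeas g) :
    asympVar K G x₀ 1 g = ∫ y, g y ^ 2 ∂(pathKernel K 0 (startPath x₀))
      - (∫ y, g y ∂(pathKernel K 0 (startPath x₀))) ^ 2 := by
  simp [asympVar, localVar, Q_self K hg, gam_one K x₀ hg, gam_one K x₀ hg.sq,
    gam_one K x₀ (BddMeas.const 1)]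

/-- Deterministic counterpart of `fluct_gamma_succ`: the terms `p ≤ n` are transported by `Q_{p,n+1}
g = Q_{p,n}(S g)`, and the new term `p = n + 1` is the limit of the conditional variance of the
sampling error. -/
lemma asympVar_succ (hG : BddPotentials G) {n : ℕ} (hn : 1 ≤ n) {g : Path E (n + 1) → ℝ}
    (hg : BddMeas g) : asympVar K G x₀ (n + 1) g
      = asympVar K G x₀ n (stepOp K G n g) + (gam K G x₀ n (G n) *
        gam K G x₀ n (stepOp K G n fun y => g y ^ 2) - gam K G x₀ n (stepOp K G n g) ^ 2) := by
  rw [asympVar, Finset.sum_Icc_succ_top (by omega), Q_self K hg, localVar,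
    gam_succ K x₀ hG hn (BddMeas.const 1), gam_succ K x₀ hG hn hg, gam_succ K x₀ hG hn hg.sq,
    stepOp_one, asympVar]
  congr 1
  refine Finset.sum_congr rfl fun p hp => ?_
  rw [Q_succ K hG (Finset.mem_Icc.1 hp).1 (Finset.mem_Icc.1 hp).2 hg]

end Variance

/-- Convexity of `exp`. The prefactor makes any sign assumption on `a` and `b` unnecessary. -/
lemma abs_exp_sub_exp_le (a b : ℝ) : |Real.exp a - Real.exp b| ≤ (Real.exp a + Real.exp b) * |a - b| := by
  have key : ∀ x y : ℝ, Real.exp x - Real.exp y ≤ Real.exp x * (x - y) := fun x y => by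
    have h1 := Real.add_one_le_exp (y - x)
    have h2 : Real.exp y = Real.exp x * Real.exp (y - x) := by rw [← Real.exp_add]; congr 1; ring
    rw [h2]; nlinarith [Real.exp_pos x]
  have ha := Real.exp_pos a
  have hb := Real.exp_pos b
  have h0 := abs_nonneg (a - b)
  rw [abs_le]
  constructor
  · nlinarith [key b a, neg_abs_le (a - b), mul_le_mul_of_nonneg_left (neg_abs_le (a - b)) hb.le]
  · nlinarith [key a b, mul_le_mul_of_nonneg_left (le_abs_self (a - b)) ha.le]

/-! ### Central limit theorem for a single `γ`-fluctuation. -/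

section Family

variable {E : ℕ → Type u} [∀ n, MeasurableSpace (E n)]
  {K : (n : ℕ) → Kernel (E n) (E (n + 1))} [∀ n, IsMarkovKernel (K n)]
  {G : (n : ℕ) → Path E n → ℝ} {x₀ : E 0} {n : ℕ} {Ω : ℕ → Type v}
  {ξ : (N : ℕ) → (p : ℕ) → Ω N → Fin N → Path E p}
  [∀ N, MeasurableSpace (Ω N)] {P : (N : ℕ) → Measure (Ω N)} [∀ N, IsProbabilityMeasure (P N)]

omit [∀ N, MeasurableSpace (Ω N)] in
lemma abs_gamN_sub_gam {N : ℕ} (hN : 1 ≤ N) (f : Path E n → ℝ) (ω : Ω N) :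
    |gamN G (ξ N) n f ω - gam K G x₀ n f| = |fluct K G x₀ (ξ N) n .gamma f ω| / Real.sqrt N := by
  have h : 0 < Real.sqrt N := Real.sqrt_pos.2 (by exact_mod_cast hN)
  simp only [fluct]
  rw [abs_mul, abs_of_pos h]
  field_simp

/-- Quantitative one-dimensional central limit theorem for `W_n^{γ,N}(g)`. -/
lemma exists_norm_charFun_fluct_sub_le (hG : BddPotentials G) (hn : 1 ≤ n)
    (hξ : ∀ N, 1 ≤ N → IsParticleSystem K G x₀ (P N) N (ξ N)) :
    ∀ {g : Path E n → ℝ}, BddMeas g → ∃ C, ∀ N, 1 ≤ N →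
      ‖∫ ω, Complex.exp ((fluct K G x₀ (ξ N) n .gamma g ω : ℝ) * Complex.I) ∂(P N)
        - (Real.exp (-(asympVar K G x₀ n g) / 2) : ℝ)‖ ≤ C / Real.sqrt N := by
  induction n, hn using Nat.le_induction with
  | base =>
    intro g hg
    obtain ⟨B, hB⟩ := hg.2
    refine ⟨(1 * (2 * B)) ^ 3 * Real.exp (1 * (2 * B)) + (1 * (2 * B)) ^ 4, fun N hN => ?_⟩
    have h := norm_integral_pi_exp_sub_le (μ := pathKernel K 0 (startPath x₀)) (θ := 1) hg.1 hB
      (le_of_eq abs_one) hN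
    have hm : Measurable fun z : Fin N → Path E 1 => avg z g := measurable_avg hg.1
    rw [← (hξ N hN).init, integral_map ((hξ N hN).measurable 1 le_rfl).aemeasurable
      (by fun_prop)] at h
    simpa only [fluct_gamma_one hg, one_mul, asympVar_one K x₀ hg, one_pow] using h
  | succ n hn ih =>
    intro g hg
    obtain ⟨B, hB⟩ := hg.2
    have hS := hg.stepOp K hG hn
    have hS2 := hg.sq.stepOp K hG hn
    have hGn := hG.bddMeas hn
    obtain ⟨C, hC⟩ := ih hS
    obtain ⟨T, hT0, hT⟩ := exists_abs_gamN_le (ξ := ξ) hG hGn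
    obtain ⟨T1, hT10, hT1⟩ := exists_abs_gamN_le (ξ := ξ) hG hS
    obtain ⟨T2, hT20, hT2⟩ := exists_abs_gamN_le (ξ := ξ) hG hS2
    obtain ⟨A, hA⟩ := exists_integral_abs_fluct_pow_le hG hn hξ hGn 1
    obtain ⟨A1, hA1⟩ := exists_integral_abs_fluct_pow_le hG hn hξ hS 1
    obtain ⟨A2, hA2⟩ := exists_integral_abs_fluct_pow_le hG hn hξ hS2 1
    simp only [pow_one] at hA hA1 hA2
    set θ₀ := gam K G x₀ n (G n) with hθ₀
    set y₀ := gam K G x₀ n (stepOp K G n g) with hy₀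
    set σ := θ₀ * gam K G x₀ n (stepOp K G n fun y => g y ^ 2) - y₀ ^ 2 with hσ
    set D := (T * (2 * B)) ^ 3 * Real.exp (T * (2 * B)) + (T * (2 * B)) ^ 4 with hD
    -- Lipschitz constant for the exponential of the variance: the conditional variance is
    -- nonnegative, so its exponential is at most 1, while nothing is needed about the sign of `σ`.
    set M := 1 + Real.exp (-σ / 2) with hM
    have hM0 : 0 < M := by positivity
    -- Three error sources: the conditional central limit theorem (`D`), the random conditional
    -- variance (the factor of `M`), and the induction hypothesis (`C`).
    refine ⟨D + M * (T2 * A + |θ₀| * A2 + (T1 + |y₀|) * A1) + Real.exp (-σ / 2) * C,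
      fun N hN => ?_⟩
    have hs : 0 < Real.sqrt N := Real.sqrt_pos.2 (by exact_mod_cast hN)
    have hp := hξ N hN
    have hm : Measurable fun z : Fin N → Path E (n + 1) => avg z g := measurable_avg hg.1
    set w : Ω N → ℝ := fun ω => fluct K G x₀ (ξ N) n .gamma (stepOp K G n g) ω with hw
    set U : Ω N → ℝ × ℝ × ℝ := fun ω => (w ω,
      gamN G (ξ N) n (G n) ω, ∫ y, g y ∂(Phi K G n (empirical (ξ N n ω)))) with hUdef
    have hU : Measurable[MeasurableSpace.comap (past (ξ N) n) inferInstance] U := by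
      let _ : MeasurableSpace (Ω N) := MeasurableSpace.comap (past (ξ N) n) inferInstance
      have hc := measurable_comap_past (ξ := ξ N) (n := n)
      exact (measurable_fluct hG hn hc hS.1 _).prodMk
        ((measurable_gamN hG hn hc (hG.measurable n hn)).prodMk
          (measurable_integral_Phi hG hn hN (hc n (by simp [hn])) hg))
    set H : (ℝ × ℝ × ℝ) × (Fin N → Path E (n + 1)) → ℂ := fun q =>
      Complex.exp ((q.1.1 + q.1.2.1 * (Real.sqrt N * (avg q.2 g - q.1.2.2)) : ℝ) * Complex.I)
      with hHdef
    have hH : StronglyMeasurable H := by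
      have hm' : Measurable fun q : (ℝ × ℝ × ℝ) × (Fin N → Path E (n + 1)) => avg q.2 g :=
        hm.comp measurable_snd
      refine Measurable.stronglyMeasurable ?_
      simp only [hHdef]
      fun_prop
    have e0 : ∀ ω, H (U ω, ξ N (n + 1) ω)
        = Complex.exp ((fluct K G x₀ (ξ N) (n + 1) .gamma g ω : ℝ) * Complex.I) :=
      fun ω => by simp only [hHdef, hUdef, hw, fluct_gamma_succ hG hn hN hg]
    have hb' := bddMeas_fluct_gamma hG (by omega) hξ hg hN
    obtain ⟨i1, e1⟩ := hp.integral_next hG hn hN hU hH (by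
      simp_rw [e0]
      have := hb'.1
      exact Integrable.of_bound (by fun_prop) 1 (Eventually.of_forall fun ω => by
        rw [Complex.norm_exp_ofReal_mul_I]))
    simp_rw [e0] at e1
    have hbw : BddMeas w := bddMeas_fluct_gamma hG hn hξ hS hN
    have iw : Integrable (fun ω => Complex.exp ((w ω : ℝ) * Complex.I)) (P N) := by
      have := hbw.1
      exact Integrable.of_bound (by fun_prop) 1 (Eventually.of_forall fun ω => by
        rw [Complex.norm_exp_ofReal_mul_I])
    have ia : ∀ {f : Path E n → ℝ}, BddMeas f →
        Integrable (fun ω => |fluct K G x₀ (ξ N) n .gamma f ω|) (P N) := fun hf =>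
      ((bddMeas_fluct_gamma hG hn hξ hf hN).integrable (P N)).abs
    set b : Ω N → ℝ := fun ω => (D + M * (T2 * |fluct K G x₀ (ξ N) n .gamma (G n) ω|
      + |θ₀| * |fluct K G x₀ (ξ N) n .gamma (stepOp K G n fun y => g y ^ 2) ω|
      + (T1 + |y₀|) * |w ω|)) / Real.sqrt N with hb
    have i2 : Integrable (fun ω => T2 * |fluct K G x₀ (ξ N) n .gamma (G n) ω|
      + |θ₀| * |fluct K G x₀ (ξ N) n .gamma (stepOp K G n fun y => g y ^ 2) ω|) (P N) :=
      ((ia hGn).const_mul _).add ((ia hS2).const_mul _)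
    have i3 : Integrable (fun ω => T2 * |fluct K G x₀ (ξ N) n .gamma (G n) ω|
      + |θ₀| * |fluct K G x₀ (ξ N) n .gamma (stepOp K G n fun y => g y ^ 2) ω|
      + (T1 + |y₀|) * |w ω|) (P N) := i2.add ((ia hS).const_mul _)
    have ib : Integrable b (P N) := ((integrable_const D).add (i3.const_mul M)).div_const _
    have hint : ∫ ω, b ω ∂(P N)
        ≤ (D + M * (T2 * A + |θ₀| * A2 + (T1 + |y₀|) * A1)) / Real.sqrt N := by
      simp only [hb]
      rw [integral_div, integral_add (integrable_const _) (i3.const_mul M), integral_const_mul,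
        integral_add i2 ((ia hS).const_mul _), integral_add ((ia hGn).const_mul _)
          ((ia hS2).const_mul _), integral_const_mul, integral_const_mul, integral_const_mul]
      have := hA N hN
      have := hA1 N hN
      have := hA2 N hN
      simp only [integral_const, probReal_univ, one_smul]
      gcongr
    have hpt : ∀ ω, ‖∫ z, H (U ω, z) ∂(Measure.pi fun _ : Fin N =>
          Phi K G n (empirical (ξ N n ω)))
        - Complex.exp ((w ω : ℝ) * Complex.I) * (Real.exp (-σ / 2) : ℝ)‖ ≤ b ω := by
      intro ω
      have := isProbabilityMeasure_Phi K hG hn hN (ξ N n ω)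
      set μ := Phi K G n (empirical (ξ N n ω)) with hμ
      set θ := gamN G (ξ N) n (G n) ω with hθ
      have c1 := norm_integral_pi_exp_sub_le (μ := μ) hg.1 hB (hT N hN ω) hN
      -- Multiplying by `θ ^ 2` absorbs the normalisation of `Φ`, which leaves a polynomial in
      -- values of `γ_n^N`.
      have hV : θ ^ 2 * (∫ a, g a ^ 2 ∂μ - (∫ a, g a ∂μ) ^ 2)
          = θ * gamN G (ξ N) n (stepOp K G n fun y => g y ^ 2) ω
            - gamN G (ξ N) n (stepOp K G n g) ω ^ 2 := by
        rw [← gamN_mul_integral_Phi hG hn hN hg, ← gamN_mul_integral_Phi hG hn hN hg.sq]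
        ring
      have hV0 : 0 ≤ θ ^ 2 * (∫ a, g a ^ 2 ∂μ - (∫ a, g a ∂μ) ^ 2) := by
        rw [← integral_sq_mul_sub_integral hg.1 hB]
        exact integral_nonneg fun a => sq_nonneg _
      rw [← hθ] at c1
      set x := gamN G (ξ N) n (stepOp K G n fun y => g y ^ 2) ω with hx
      set y := gamN G (ξ N) n (stepOp K G n g) ω with hy
      rw [hV] at c1 hV0
      have c2 : |Real.exp (-(θ * x - y ^ 2) / 2) - Real.exp (-σ / 2)|
          ≤ M * |θ * x - y ^ 2 - σ| := by
        refine (abs_exp_sub_exp_le _ _).trans ?_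
        have h1 : Real.exp (-(θ * x - y ^ 2) / 2) ≤ 1 := Real.exp_le_one_iff.2 (by linarith)
        have h2 : |-(θ * x - y ^ 2) / 2 - -σ / 2| ≤ |θ * x - y ^ 2 - σ| := by
          have : -(θ * x - y ^ 2) / 2 - -σ / 2 = -((θ * x - y ^ 2 - σ) / 2) := by ring
          rw [this, abs_neg, abs_div, abs_two]
          linarith [abs_nonneg (θ * x - y ^ 2 - σ)]
        exact mul_le_mul (by linarith) h2 (abs_nonneg _) hM0.le
      have c3 : |θ * x - y ^ 2 - σ| ≤ (T2 * |fluct K G x₀ (ξ N) n .gamma (G n) ω|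
          + |θ₀| * |fluct K G x₀ (ξ N) n .gamma (stepOp K G n fun y => g y ^ 2) ω|
          + (T1 + |y₀|) * |w ω|) / Real.sqrt N := by
        have d1 := abs_gamN_sub_gam (K := K) (G := G) (x₀ := x₀) (ξ := ξ) hN (G n) ω
        have d2 := abs_gamN_sub_gam (K := K) (G := G) (x₀ := x₀) (ξ := ξ) hN
          (stepOp K G n fun y => g y ^ 2) ω
        have d3 := abs_gamN_sub_gam (K := K) (G := G) (x₀ := x₀) (ξ := ξ) hN (stepOp K G n g) ω
        rw [add_div, add_div, mul_div_assoc, mul_div_assoc, mul_div_assoc, hw, ← d1, ← d2, ← d3]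
        -- Each summand contains one difference `γ_n^N - γ_n`, which is a fluctuation divided by
        -- `√N`.
        have e : θ * x - y ^ 2 - σ = x * (θ - θ₀)
            + θ₀ * (x - gam K G x₀ n (stepOp K G n fun y => g y ^ 2)) + -((y + y₀) * (y - y₀)) := by
          rw [hσ]; ring
        rw [e]
        refine (abs_add_three _ _ _).trans ?_
        rw [abs_neg, abs_mul, abs_mul, abs_mul]
        have hxx := hT2 N hN ω
        have hyy : |y + y₀| ≤ T1 + |y₀| := (abs_add_le _ _).trans (by linarith [hT1 N hN ω])
        gcongr
      have c4 : ∫ z, H (U ω, z) ∂(Measure.pi fun _ : Fin N => μ)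
          = Complex.exp ((w ω : ℝ) * Complex.I) *
            ∫ z, Complex.exp ((θ * (Real.sqrt N * (avg z g - ∫ a, g a ∂μ)) : ℝ) * Complex.I)
              ∂(Measure.pi fun _ : Fin N => μ) := by
        rw [← integral_const_mul]
        refine integral_congr_ae (Eventually.of_forall fun z => ?_)
        simp only [hHdef, hUdef]
        rw [← Complex.exp_add, Complex.ofReal_add, add_mul]
      rw [c4, ← mul_sub, norm_mul, Complex.norm_exp_ofReal_mul_I, one_mul]
      refine (norm_sub_le_norm_sub_add_norm_sub _
        ((Real.exp (-(θ * x - y ^ 2) / 2) : ℝ) : ℂ) _).trans ?_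
      rw [← Complex.ofReal_sub, Complex.norm_real, Real.norm_eq_abs]
      refine (add_le_add c1 (c2.trans (mul_le_mul_of_nonneg_left c3 hM0.le))).trans (le_of_eq ?_)
      simp only [hb]; ring
    have hvar : ((Real.exp (-(asympVar K G x₀ (n + 1) g) / 2) : ℝ) : ℂ)
        = (Real.exp (-(asympVar K G x₀ n (stepOp K G n g)) / 2) : ℝ) * (Real.exp (-σ / 2) : ℝ) := by
      rw [asympVar_succ K x₀ hG hn hg, ← Complex.ofReal_mul, ← Real.exp_add]
      congr 2
      rw [hσ]; ring
    rw [e1, hvar]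
    -- The intermediate term freezes the conditional variance at `σ`; the induction hypothesis then
    -- handles the remaining factor.
    refine (norm_sub_le_norm_sub_add_norm_sub _
      (∫ ω, Complex.exp ((w ω : ℝ) * Complex.I) * (Real.exp (-σ / 2) : ℝ) ∂(P N)) _).trans ?_
    rw [add_div]
    refine add_le_add ?_ ?_
    · rw [← integral_sub i1 (iw.mul_const _)]
      exact (norm_integral_le_of_norm_le ib (Eventually.of_forall hpt)).trans hint
    · rw [integral_mul_const, ← sub_mul, norm_mul, Complex.norm_real, Real.norm_eq_abs,
        abs_of_pos (Real.exp_pos _), mul_comm, mul_div_assoc]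
      exact mul_le_mul_of_nonneg_left (hC N hN) (Real.exp_pos _).le

end Family

/-! ### Characteristic function of the limiting Gaussian field. -/

section Limit

variable {E : ℕ → Type u} [∀ n, MeasurableSpace (E n)]
  {K : (n : ℕ) → Kernel (E n) (E (n + 1))} [∀ n, IsMarkovKernel (K n)]
  {G : (n : ℕ) → Path E n → ℝ} {x₀ : E 0} {n : ℕ}
  {Ω' : Type w} [MeasurableSpace Ω'] {P' : Measure Ω'}
  {W : (p : ℕ) → (Path E p → ℝ) → Ω' → ℝ}

lemma gam_one_sq_mul_eta_covariance (hG : BddPotentials G) {p : ℕ} (hp : 1 ≤ p)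
    {h k : Path E p → ℝ} (hh : BddMeas h) (hk : BddMeas k) :
    gam K G x₀ p (fun _ => 1) ^ 2 *
        eta K G x₀ p (fun y => (h y - eta K G x₀ p h) * (k y - eta K G x₀ p k))
      = gam K G x₀ p (fun _ => 1) * gam K G x₀ p (fun y => h y * k y)
        - gam K G x₀ p h * gam K G x₀ p k := by
  have h0 := (gam_const_one_pos K x₀ hG hp).ne'
  set a := eta K G x₀ p h with ha
  set b := eta K G x₀ p k with hb
  -- The expanded product is a linear combination of four bounded functions, to which linearity of
  -- `gam` applies.
  have e : (fun y => (h y - a) * (k y - b)) = fun y => ∑ i : Fin 4, ![1, -b, -a, a * b] i *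
      (![fun y => h y * k y, h, k, fun _ => 1] : Fin 4 → Path E p → ℝ) i y := by
    ext y; simp [Fin.sum_univ_four]; ring
  have hf : ∀ i, BddMeas ((![fun y => h y * k y, h, k, fun _ => 1] : Fin 4 → Path E p → ℝ) i) := by
    intro i
    fin_cases i
    · exact hh.mul hk
    · exact hh
    · exact hk
    · exact BddMeas.const 1
  have e2 : gam K G x₀ p (fun y => (h y - a) * (k y - b)) = gam K G x₀ p (fun y => h y * k y)
      - b * gam K G x₀ p h - a * gam K G x₀ p k + a * b * gam K G x₀ p (fun _ => 1) := by
    rw [e, gam_sum K x₀ hG hf]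
    simp [Fin.sum_univ_four]; ring
  rw [show eta K G x₀ p (fun y => (h y - a) * (k y - b))
    = gam K G x₀ p (fun y => (h y - a) * (k y - b)) / gam K G x₀ p (fun _ => 1) from rfl, e2, ha, hb]
  simp only [eta]
  field_simp
  ring

lemma localVar_sum (hG : BddPotentials G) {p : ℕ} {ι : Type*} [Fintype ι]
    {h : ι → Path E p → ℝ} (hh : ∀ i, BddMeas (h i)) (u : ι → ℝ) :
    localVar K G x₀ p (fun y => ∑ i, u i * h i y)
      = ∑ i, ∑ j, u i * u j * (gam K G x₀ p (fun _ => 1) * gam K G x₀ p (fun y => h i y * h j y)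
        - gam K G x₀ p (h i) * gam K G x₀ p (h j)) := by
  have e : (fun y => (∑ i, u i * h i y) ^ 2)
      = fun y => ∑ q : ι × ι, (u q.1 * u q.2) * (h q.1 y * h q.2 y) := by
    ext y
    rw [pow_two, Finset.sum_mul_sum, Fintype.sum_prod_type]
    exact Finset.sum_congr rfl fun i _ => Finset.sum_congr rfl fun j _ => by ring
  rw [localVar, e, gam_sum K x₀ hG hh,
    gam_sum K x₀ hG (f := fun q : ι × ι => fun y => h q.1 y * h q.2 y)
      (fun q => (hh q.1).mul (hh q.2)) (fun q => u q.1 * u q.2), pow_two, Finset.sum_mul_sum,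
    Finset.mul_sum, Fintype.sum_prod_type, ← Finset.sum_sub_distrib]
  refine Finset.sum_congr rfl fun i _ => ?_
  rw [← Finset.sum_sub_distrib]
  exact Finset.sum_congr rfl fun j _ => by ring

lemma IsLimitField.hasGaussianLaw_sum (hW : IsLimitField K G x₀ P' n W) {p : ℕ}
    (hp : p ∈ Finset.Icc 1 n) {ι : Type*} [Fintype ι] {h : ι → Path E p → ℝ}
    (hh : ∀ i, BddMeas (h i)) (c : ι → ℝ) :
    HasGaussianLaw (fun ω => ∑ i, c i * W p (h i) ω) P' :=
  (((hW.gaussian p hp).comp_right fun i => ⟨h i, hh i⟩).smul c).hasGaussianLaw_fun_sum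
    (I := Finset.univ)

lemma IsLimitField.memLp (hW : IsLimitField K G x₀ P' n W) {p : ℕ} (hp : p ∈ Finset.Icc 1 n)
    {h : Path E p → ℝ} (hh : BddMeas h) {q : ℝ≥0∞} (hq : q ≠ ∞) : MemLp (W p h) q P' :=
  ((hW.gaussian p hp).hasGaussianLaw_eval ⟨h, hh⟩).memLp hq

/-- `W p` is not assumed linear in its argument. The finite combination is nevertheless Gaussian,
and its mean and variance follow from the prescribed means and covariances, which are bilinear. -/
lemma IsLimitField.charFun_sum (hW : IsLimitField K G x₀ P' n W) (hG : BddPotentials G) {p : ℕ}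
    (hp : p ∈ Finset.Icc 1 n) {ι : Type*} [Fintype ι] {h : ι → Path E p → ℝ}
    (hh : ∀ i, BddMeas (h i)) (u : ι → ℝ) :
    charFun (P'.map fun ω => ∑ i, gam K G x₀ p (fun _ => 1) * u i * W p (h i) ω) 1
      = (Real.exp (-(localVar K G x₀ p fun y => ∑ i, u i * h i y) / 2) : ℝ) := by
  set γ := gam K G x₀ p (fun _ => 1) with hγ
  have hY := hW.hasGaussianLaw_sum hp hh fun i => γ * u i
  have i1 : ∀ i, Integrable (fun ω => γ * u i * W p (h i) ω) P' := fun i =>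
    (memLp_one_iff_integrable.1 (hW.memLp hp (hh i) (by simp))).const_mul _
  have i2 : ∀ i j, Integrable (fun ω => γ * u i * W p (h i) ω * (γ * u j * W p (h j) ω)) P' :=
    fun i j => by
      have := ((hW.memLp hp (hh i) (q := 2) (by simp)).integrable_mul
        (hW.memLp hp (hh j) (q := 2) (by simp))).const_mul (γ * u i * (γ * u j))
      refine this.congr (Eventually.of_forall fun ω => ?_)
      simp only [Pi.mul_apply]; ring
  have hmean : ∫ ω, ∑ i, γ * u i * W p (h i) ω ∂P' = 0 := by
    rw [integral_finsetSum _ fun i _ => i1 i]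
    exact Finset.sum_eq_zero fun i _ => by
      rw [integral_const_mul, hW.centered p hp _ (hh i), mul_zero]
  have hvar : Var[fun ω => ∑ i, γ * u i * W p (h i) ω; P']
      = localVar K G x₀ p fun y => ∑ i, u i * h i y := by
    rw [variance_of_integral_eq_zero hY.aemeasurable hmean, localVar_sum hG hh]
    simp_rw [pow_two, Finset.sum_mul_sum]
    rw [integral_finsetSum _ fun i _ => integrable_finsetSum _ fun j _ => i2 i j]
    refine Finset.sum_congr rfl fun i _ => ?_
    rw [integral_finsetSum _ fun j _ => i2 i j]
    refine Finset.sum_congr rfl fun j _ => ?_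
    rw [← gam_one_sq_mul_eta_covariance hG (Finset.mem_Icc.1 hp).1 (hh i) (hh j),
      ← hW.covariance p hp _ _ (hh i) (hh j), ← integral_const_mul, ← integral_const_mul]
    refine integral_congr_ae (Eventually.of_forall fun ω => ?_)
    simp only; ring
  rw [hY.charFun_map_eq]
  have hin : ∀ x : ℝ, inner ℝ (1 : ℝ) x = x := fun x => by simp
  simp only [hin, hmean, hvar]
  simp [neg_div]

omit [MeasurableSpace Ω'] in
lemma limitGam_sum {ι : Type*} [Fintype ι] (g : ι → Path E n → ℝ) (u : ι → ℝ) (ω : Ω') :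
    ∑ i, u i * limitGam K G x₀ W n (g i) ω = ∑ p : Finset.Icc 1 n,
      ∑ i, gam K G x₀ p (fun _ => 1) * u i * W p (Q K G p n (g i)) ω := by
  rw [Finset.sum_coe_sort (Finset.Icc 1 n) fun p =>
    ∑ i, gam K G x₀ p (fun _ => 1) * u i * W p (Q K G p n (g i)) ω, Finset.sum_comm]
  refine Finset.sum_congr rfl fun i _ => ?_
  rw [limitGam, Finset.mul_sum]
  exact Finset.sum_congr rfl fun p _ => by ring

/-- Joint characteristic function of the limiting Gaussian fields. -/
lemma IsLimitField.integral_exp_sum_limitGam (hW : IsLimitField K G x₀ P' n W)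
    (hG : BddPotentials G) {ι : Type*} [Fintype ι] {g : ι → Path E n → ℝ}
    (hg : ∀ i, BddMeas (g i)) (u : ι → ℝ) :
    ∫ ω, Complex.exp ((∑ i, u i * limitGam K G x₀ W n (g i) ω : ℝ) * Complex.I) ∂P'
      = (Real.exp (-(asympVar K G x₀ n fun y => ∑ i, u i * g i y) / 2) : ℝ) := by
  have hQ : ∀ p ∈ Finset.Icc 1 n, ∀ i, BddMeas (Q K G p n (g i)) := fun p hp i =>
    (hg i).Q K hG (Finset.mem_Icc.1 hp).1 (Finset.mem_Icc.1 hp).2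
  set Y : Finset.Icc 1 n → Ω' → ℝ := fun p ω =>
    ∑ i, gam K G x₀ p (fun _ => 1) * u i * W p (Q K G p n (g i)) ω with hYdef
  have hY : ∀ p, AEMeasurable (Y p) P' := fun p =>
    (hW.hasGaussianLaw_sum p.2 (hQ p p.2) fun i => gam K G x₀ p (fun _ => 1) * u i).aemeasurable
  -- `Y p` is a measurable function of finitely many coordinates of the field `W p`, so independence
  -- of the fields passes to it.
  have hind : iIndepFun Y P' := hW.indep.comp (fun p φ =>
    ∑ i, gam K G x₀ p (fun _ => 1) * u i * φ ⟨Q K G p n (g i), hQ p p.2 i⟩) fun p =>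
      Finset.measurable_sum _ fun i _ => (measurable_pi_apply _).const_mul _
  have h1 := congrFun (hind.charFun_map_fun_sum_eq_prod hY) 1
  rw [charFun_apply_real, integral_map (by fun_prop) (by fun_prop)] at h1
  simp only [Complex.ofReal_one, one_mul] at h1
  simp_rw [limitGam_sum]
  rw [h1, Finset.prod_apply]
  have h2 : ∀ p : Finset.Icc 1 n, charFun (P'.map (Y p)) 1
      = (Real.exp (-(localVar K G x₀ p (Q K G p n fun y => ∑ i, u i * g i y)) / 2) : ℝ) := by
    intro p
    rw [Q_sum K hG (Finset.mem_Icc.1 p.2).1 hg]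
    exact hW.charFun_sum hG p.2 (hQ p p.2) u
  simp_rw [h2]
  rw [← Complex.ofReal_prod, ← Real.exp_sum, asympVar, ← Finset.sum_div, Finset.sum_neg_distrib,
    Finset.sum_coe_sort (Finset.Icc 1 n) fun p =>
      localVar K G x₀ p (Q K G p n fun y => ∑ i, u i * g i y)]

lemma IsLimitField.memLp_limitGam (hW : IsLimitField K G x₀ P' n W) (hG : BddPotentials G)
    {g : Path E n → ℝ} (hg : BddMeas g) {q : ℝ≥0∞} (hq : q ≠ ∞) :
    MemLp (limitGam K G x₀ W n g) q P' :=
  memLp_finsetSum _ fun _ hp => (hW.memLp hp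
    (hg.Q K hG (Finset.mem_Icc.1 hp).1 (Finset.mem_Icc.1 hp).2) hq).const_mul _

end Limit

lemma norm_exp_mul_I_sub_exp_mul_I_le (x y : ℝ) :
    ‖Complex.exp (x * Complex.I) - Complex.exp (y * Complex.I)‖ ≤ |x - y| := by
  have e : Complex.exp (x * Complex.I) - Complex.exp (y * Complex.I)
      = Complex.exp (y * Complex.I) * (Complex.exp (Complex.I * (x - y : ℝ)) - 1) := by
    rw [mul_sub, ← Complex.exp_add, mul_one]
    congr 2
    push_cast; ring
  rw [e, norm_mul, Complex.norm_exp_ofReal_mul_I, one_mul]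
  exact Real.norm_exp_I_mul_ofReal_sub_one_le

/-- Every factor is dominated by the largest one. For `d = 0` the bound would read `1 ≤ 0`. -/
lemma prod_sq_le_sum_pow {d : ℕ} (hd : 1 ≤ d) (x : Fin d → ℝ) :
    (∏ i, x i) ^ 2 ≤ ∑ i, |x i| ^ (2 * d) := by
  have : Nonempty (Fin d) := ⟨⟨0, hd⟩⟩
  obtain ⟨j, -, hj⟩ := Finset.exists_max_image Finset.univ (fun i => |x i|) Finset.univ_nonempty
  calc (∏ i, x i) ^ 2 = (∏ i, |x i|) ^ 2 := by rw [← Finset.abs_prod, sq_abs]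
    _ ≤ (∏ _i : Fin d, |x j|) ^ 2 := by
        refine pow_le_pow_left₀ (Finset.prod_nonneg fun _ _ => abs_nonneg _) ?_ 2
        exact Finset.prod_le_prod (fun _ _ => abs_nonneg _) hj
    _ = |x j| ^ (2 * d) := by simp [← pow_mul, mul_comm]
    _ ≤ _ := Finset.single_le_sum (f := fun i => |x i| ^ (2 * d)) (fun _ _ => by positivity)
        (Finset.mem_univ j)

/-! ### Reduction of `η`-fluctuations to `γ`-fluctuations. -/

section Renormalisation

variable {E : ℕ → Type u} [∀ n, MeasurableSpace (E n)]
  (K : (n : ℕ) → Kernel (E n) (E (n + 1))) [∀ n, IsMarkovKernel (K n)]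
  (G : (n : ℕ) → Path E n → ℝ) (x₀ : E 0)

/-- The function `g` such that `W_n^ν(f) = W_n^γ(g)`. -/
def centredFun (n : ℕ) : Kind → (Path E n → ℝ) → Path E n → ℝ
  | .gamma, f => f
  | .eta, f => fun y => 1 / gam K G x₀ n (fun _ => 1) * (f y - eta K G x₀ n f)

variable {K G x₀}

lemma limitFluct_eq {Ω' : Type w} (W : (p : ℕ) → (Path E p → ℝ) → Ω' → ℝ) (n : ℕ) (ν : Kind)
    (f : Path E n → ℝ) :
    limitFluct K G x₀ W n ν f = limitGam K G x₀ W n (centredFun K G x₀ n ν f) := by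
  cases ν <;> rfl

lemma BddMeas.centredFun {n : ℕ} {f : Path E n → ℝ} (hf : BddMeas f) (ν : Kind) :
    BddMeas (centredFun K G x₀ n ν f) := by
  cases ν
  · exact hf
  · exact (BddMeas.const _).mul (hf.sub (BddMeas.const _))

/-- Since `γ_n(f - η_n(f)) = 0`, no deterministic centring remains on the right. -/
lemma fluct_gamma_centredFun (hG : BddPotentials G) {n : ℕ} (hn : 1 ≤ n) {Ω : Type v} {N : ℕ}
    {ξ : (p : ℕ) → Ω → Fin N → Path E p} {f : Path E n → ℝ} (hf : BddMeas f) (ω : Ω) :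
    fluct K G x₀ ξ n .gamma (centredFun K G x₀ n .eta f) ω
      = Real.sqrt N * (1 / gam K G x₀ n (fun _ => 1) *
        (gamN G ξ n f ω - eta K G x₀ n f * gamN G ξ n (fun _ => 1) ω)) := by
  have h0 := (gam_const_one_pos K x₀ hG hn).ne'
  set γ := gam K G x₀ n (fun _ => 1) with hγ
  have e : centredFun K G x₀ n .eta f = fun y => ∑ i : Fin 2, ![1 / γ, -(eta K G x₀ n f / γ)] i *
      (![f, fun _ => 1] : Fin 2 → Path E n → ℝ) i y := by
    ext y; simp [centredFun, ← hγ]; ring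
  have hb : ∀ i, BddMeas ((![f, fun _ => 1] : Fin 2 → Path E n → ℝ) i) := by
    intro i
    fin_cases i
    · exact hf
    · exact BddMeas.const 1
  rw [e, fluct_gamma_sum hG hb]
  simp only [fluct, Fin.sum_univ_two, Matrix.cons_val_zero, Matrix.cons_val_one, ← hγ]
  have : eta K G x₀ n f = gam K G x₀ n f / γ := rfl
  rw [this]
  field_simp
  ring

/-- `η_n^N` is `γ_n^N` divided by its random mass `γ_n^N(1)`, while `centredFun` divides by the
limit mass; the ratio corrects this. -/
lemma fluct_eta_eq (hG : BddPotentials G) {n : ℕ} (hn : 1 ≤ n) {Ω : Type v} {N : ℕ} (hN : 1 ≤ N)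
    {ξ : (p : ℕ) → Ω → Fin N → Path E p} {f : Path E n → ℝ} (hf : BddMeas f) (ω : Ω) :
    fluct K G x₀ ξ n .eta f ω
      = gam K G x₀ n (fun _ => 1) / gamN G ξ n (fun _ => 1) ω *
        fluct K G x₀ ξ n .gamma (centredFun K G x₀ n .eta f) ω := by
  have h0 := (gam_const_one_pos K x₀ hG hn).ne'
  have h1 := (gamN_pos (ξ := ξ) (n := n) hG hN ω).ne'
  rw [fluct_gamma_centredFun hG hn hf, gamN_eq_mul_etaN (f := f) hN]
  simp only [fluct]
  field_simp

end Renormalisation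

/-! ### Joint convergence and moments for both kinds of fluctuations. -/

section Family

variable {E : ℕ → Type u} [∀ n, MeasurableSpace (E n)]
  {K : (n : ℕ) → Kernel (E n) (E (n + 1))} [∀ n, IsMarkovKernel (K n)]
  {G : (n : ℕ) → Path E n → ℝ} {x₀ : E 0} {n : ℕ} {Ω : ℕ → Type v}
  {ξ : (N : ℕ) → (p : ℕ) → Ω N → Fin N → Path E p}

lemma exists_abs_fluct_le_mul (hG : BddPotentials G) (hn : 1 ≤ n) {f : Path E n → ℝ}
    (hf : BddMeas f) (ν : Kind) : ∃ A, 0 < A ∧ ∀ N, 1 ≤ N → ∀ ω : Ω N,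
      |fluct K G x₀ (ξ N) n ν f ω|
        ≤ A * |fluct K G x₀ (ξ N) n .gamma (centredFun K G x₀ n ν f) ω| := by
  cases ν with
  | gamma => exact ⟨1, one_pos, fun N _ ω => by simp [centredFun]⟩
  | eta =>
    obtain ⟨c, hc, h⟩ := exists_le_gamN_one (ξ := ξ) hG n
    have h0 := gam_const_one_pos K x₀ hG hn
    refine ⟨gam K G x₀ n (fun _ => 1) / c, div_pos h0 hc, fun N hN ω => ?_⟩
    rw [fluct_eta_eq hG hn hN hf, abs_mul]
    have h1 := h N hN ω
    rw [abs_of_pos (div_pos h0 (hc.trans_le h1))]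
    gcongr

/-- The ratio `γ_n(1) / γ_n^N(1)` minus 1 is the fluctuation of the constant 1 over `√N`, up to sign
and a denominator bounded below. The product of two fluctuations is then bounded by their squares.
-/
lemma exists_abs_fluct_sub_le (hG : BddPotentials G) (hn : 1 ≤ n) {f : Path E n → ℝ}
    (hf : BddMeas f) (ν : Kind) : ∃ A, 0 < A ∧ ∀ N, 1 ≤ N → ∀ ω : Ω N,
      |fluct K G x₀ (ξ N) n ν f ω - fluct K G x₀ (ξ N) n .gamma (centredFun K G x₀ n ν f) ω|
        ≤ A / Real.sqrt N * (|fluct K G x₀ (ξ N) n .gamma (fun _ => 1) ω| ^ 2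
          + |fluct K G x₀ (ξ N) n .gamma (centredFun K G x₀ n ν f) ω| ^ 2) := by
  cases ν with
  | gamma => exact ⟨1, one_pos, fun N _ ω => by simp [centredFun]; positivity⟩
  | eta =>
    obtain ⟨c, hc, h⟩ := exists_le_gamN_one (ξ := ξ) hG n
    refine ⟨1 / c, by positivity, fun N hN ω => ?_⟩
    have hs : 0 < Real.sqrt N := Real.sqrt_pos.2 (by exact_mod_cast hN)
    have h1 := h N hN ω
    have h2 := hc.trans_le h1
    rw [fluct_eta_eq hG hn hN hf]
    set g := fluct K G x₀ (ξ N) n .gamma (centredFun K G x₀ n .eta f) ω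
    have d := abs_gamN_sub_gam (K := K) (G := G) (x₀ := x₀) (ξ := ξ) hN
      (fun _ : Path E n => 1) ω
    set e := |fluct K G x₀ (ξ N) n .gamma (fun _ => 1) ω|
    set γN := gamN G (ξ N) n (fun _ => 1) ω
    have he : gam K G x₀ n (fun _ => 1) / γN * g - g
        = -(γN - gam K G x₀ n (fun _ => 1)) * g / γN := by
      field_simp; ring
    rw [he, abs_div, abs_mul, abs_neg, d, abs_of_pos h2]
    have he0 : 0 ≤ e := abs_nonneg _
    calc e / Real.sqrt N * |g| / γN ≤ e / Real.sqrt N * |g| / c := by gcongr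
      _ = 1 / c / Real.sqrt N * (e * |g|) := by field_simp
      _ ≤ _ := by
          gcongr
          nlinarith [sq_nonneg (e - |g|), sq_nonneg e, sq_nonneg |g|]

/-- Nothing is assumed about `ξ 0`, yet measurability and integrability are claimed for every `N`;
the factor `√0` settles this case. -/
lemma fluct_zero_particles (ν : Kind) (f : Path E n → ℝ) (ω : Ω 0) :
    fluct K G x₀ (ξ 0) n ν f ω = 0 := by
  cases ν <;> simp [fluct]

variable [∀ N, MeasurableSpace (Ω N)] {P : (N : ℕ) → Measure (Ω N)}
  [∀ N, IsProbabilityMeasure (P N)]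

omit [∀ N, IsProbabilityMeasure (P N)] in
lemma bddMeas_fluct (hG : BddPotentials G) (hn : 1 ≤ n)
    (hξ : ∀ N, 1 ≤ N → IsParticleSystem K G x₀ (P N) N (ξ N))
    {f : Path E n → ℝ} (hf : BddMeas f) (ν : Kind) (N : ℕ) :
    BddMeas fun ω => fluct K G x₀ (ξ N) n ν f ω := by
  rcases Nat.eq_zero_or_pos N with rfl | hN
  · simp_rw [fluct_zero_particles]
    exact BddMeas.const 0
  · obtain ⟨C, hC⟩ := (bddMeas_fluct_gamma hG hn hξ
      (hf.centredFun (K := K) (G := G) (x₀ := x₀) ν) hN).2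
    obtain ⟨A, hA0, hA⟩ := exists_abs_fluct_le_mul (K := K) (x₀ := x₀) (ξ := ξ) hG hn hf ν
    exact ⟨measurable_fluct hG hn (fun p hp => (hξ N hN).measurable p (Finset.mem_Icc.1 hp).1) hf.1 ν,
      A * C, fun ω => (hA N hN ω).trans (mul_le_mul_of_nonneg_left (hC ω) hA0.le)⟩

lemma exists_integral_abs_fluct_sub_le (hG : BddPotentials G) (hn : 1 ≤ n)
    (hξ : ∀ N, 1 ≤ N → IsParticleSystem K G x₀ (P N) N (ξ N))
    {f : Path E n → ℝ} (hf : BddMeas f) (ν : Kind) : ∃ C, ∀ N, 1 ≤ N →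
      ∫ ω, |fluct K G x₀ (ξ N) n ν f ω
        - fluct K G x₀ (ξ N) n .gamma (centredFun K G x₀ n ν f) ω| ∂(P N) ≤ C / Real.sqrt N := by
  have hg := hf.centredFun (K := K) (G := G) (x₀ := x₀) ν
  obtain ⟨A, hA0, hA⟩ := exists_abs_fluct_sub_le (K := K) (x₀ := x₀) (ξ := ξ) hG hn hf ν
  obtain ⟨C1, hC1⟩ := exists_integral_abs_fluct_pow_le hG hn hξ (BddMeas.const 1) 2
  obtain ⟨C2, hC2⟩ := exists_integral_abs_fluct_pow_le hG hn hξ hg 2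
  refine ⟨A * (C1 + C2), fun N hN => ?_⟩
  have i1 : Integrable (fun ω => |fluct K G x₀ (ξ N) n .gamma (fun _ => 1) ω| ^ 2) (P N) :=
    (bddMeas_fluct_gamma hG hn hξ (BddMeas.const 1) hN).abs.sq.integrable _
  have i2 : Integrable
      (fun ω => |fluct K G x₀ (ξ N) n .gamma (centredFun K G x₀ n ν f) ω| ^ 2) (P N) :=
    (bddMeas_fluct_gamma hG hn hξ hg hN).abs.sq.integrable _
  have i3 : Integrable (fun ω => |fluct K G x₀ (ξ N) n .gamma (fun _ => 1) ω| ^ 2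
      + |fluct K G x₀ (ξ N) n .gamma (centredFun K G x₀ n ν f) ω| ^ 2) (P N) := i1.add i2
  refine (integral_mono_of_nonneg (Eventually.of_forall fun ω => abs_nonneg _)
    (i3.const_mul _) (Eventually.of_forall (hA N hN))).trans ?_
  rw [integral_const_mul, integral_add i1 i2, mul_div_right_comm]
  gcongr
  · exact hC1 N hN
  · exact hC2 N hN

/-- The joint characteristic functions of the fluctuation fields converge. -/
lemma tendsto_charFun_fluct (hG : BddPotentials G) (hn : 1 ≤ n)
    (hξ : ∀ N, 1 ≤ N → IsParticleSystem K G x₀ (P N) N (ξ N)) {d : ℕ}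
    {f : Fin d → Path E n → ℝ} (hf : ∀ i, BddMeas (f i)) (ν : Fin d → Kind) (u : Fin d → ℝ) :
    Tendsto (fun N => ∫ ω, Complex.exp
        ((∑ i, u i * fluct K G x₀ (ξ N) n (ν i) (f i) ω : ℝ) * Complex.I) ∂(P N)) atTop
      (𝓝 (Real.exp (-(asympVar K G x₀ n fun y =>
        ∑ i, u i * centredFun K G x₀ n (ν i) (f i) y) / 2) : ℝ)) := by
  have hg := fun i => (hf i).centredFun (K := K) (G := G) (x₀ := x₀) (ν i)
  have hgs : BddMeas fun y => ∑ i, u i * centredFun K G x₀ n (ν i) (f i) y :=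
    BddMeas.sum _ fun i _ => (BddMeas.const _).mul (hg i)
  choose C hC using fun i => exists_integral_abs_fluct_sub_le (x₀ := x₀) hG hn hξ (hf i) (ν i)
  obtain ⟨C', hC'⟩ := exists_norm_charFun_fluct_sub_le hG hn hξ hgs
  have hlim : Tendsto (fun N : ℕ => (∑ i, |u i| * C i + C') / Real.sqrt N) atTop (𝓝 0) :=
    tendsto_const_nhds.div_atTop
      (Real.tendsto_sqrt_atTop.comp tendsto_natCast_atTop_atTop)
  rw [tendsto_iff_norm_sub_tendsto_zero]
  refine squeeze_zero' (Eventually.of_forall fun N => norm_nonneg _) ?_ hlim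
  filter_upwards [eventually_ge_atTop 1] with N hN
  have hF := fun i => bddMeas_fluct hG hn hξ (hf i) (ν i) N
  have hF' := fun i => bddMeas_fluct_gamma hG hn hξ (hg i) hN
  have iexp : ∀ {h : Ω N → ℝ}, BddMeas h →
      Integrable (fun ω => Complex.exp ((h ω : ℝ) * Complex.I)) (P N) := fun hh => by
    have := hh.1
    exact Integrable.of_bound (by fun_prop) 1 (Eventually.of_forall fun ω => by
      rw [Complex.norm_exp_ofReal_mul_I])
  have idiff : ∀ i, Integrable (fun ω => |u i| * |fluct K G x₀ (ξ N) n (ν i) (f i) ω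
      - fluct K G x₀ (ξ N) n .gamma (centredFun K G x₀ n (ν i) (f i)) ω|) (P N) := fun i =>
    (((hF i).sub (hF' i)).integrable (P N)).abs.const_mul _
  -- All fluctuations are first replaced by `γ`-fluctuations, whose linear combination is that of a
  -- single function; the one-function limit theorem then applies.
  refine (norm_sub_le_norm_sub_add_norm_sub _ (∫ ω, Complex.exp ((fluct K G x₀ (ξ N) n .gamma
    (fun y => ∑ i, u i * centredFun K G x₀ n (ν i) (f i) y) ω : ℝ) * Complex.I) ∂(P N)) _).trans ?_
  rw [add_div]
  refine add_le_add ?_ (hC' N hN)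
  rw [← integral_sub (iexp (BddMeas.sum _ fun i _ => (BddMeas.const (u i)).mul (hF i)))
    (iexp (bddMeas_fluct_gamma hG hn hξ hgs hN))]
  refine (norm_integral_le_of_norm_le (integrable_finsetSum Finset.univ fun i _ => idiff i)
    (Eventually.of_forall fun ω => ?_)).trans ?_
  · refine (norm_exp_mul_I_sub_exp_mul_I_le _ _).trans ?_
    rw [fluct_gamma_sum hG hg, ← Finset.sum_sub_distrib]
    refine (Finset.abs_sum_le_sum_abs _ _).trans (le_of_eq ?_)
    exact Finset.sum_congr rfl fun i _ => by rw [← mul_sub, abs_mul]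
  · rw [integral_finsetSum _ fun i _ => idiff i, Finset.sum_div]
    refine Finset.sum_le_sum fun i _ => ?_
    rw [integral_const_mul, mul_div_assoc]
    exact mul_le_mul_of_nonneg_left (hC i N hN) (abs_nonneg _)

/-- Uniform bound on the second moments of products of fluctuations. -/
lemma exists_integral_prod_fluct_sq_le (hG : BddPotentials G) (hn : 1 ≤ n)
    (hξ : ∀ N, 1 ≤ N → IsParticleSystem K G x₀ (P N) N (ξ N)) {d : ℕ} (hd : 1 ≤ d)
    {f : Fin d → Path E n → ℝ} (hf : ∀ i, BddMeas (f i)) (ν : Fin d → Kind) :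
    ∃ C, ∀ N, 1 ≤ N → ∫ ω, (∏ i, fluct K G x₀ (ξ N) n (ν i) (f i) ω) ^ 2 ∂(P N) ≤ C := by
  have hg := fun i => (hf i).centredFun (K := K) (G := G) (x₀ := x₀) (ν i)
  choose A hA0 hA using fun i =>
    exists_abs_fluct_le_mul (K := K) (x₀ := x₀) (ξ := ξ) hG hn (hf i) (ν i)
  choose C hC using fun i => exists_integral_abs_fluct_pow_le hG hn hξ (hg i) (2 * d)
  refine ⟨∑ i, A i ^ (2 * d) * C i, fun N hN => ?_⟩
  have hi : ∀ i, Integrable (fun ω => A i ^ (2 * d) * |fluct K G x₀ (ξ N) n .gamma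
      (centredFun K G x₀ n (ν i) (f i)) ω| ^ (2 * d)) (P N) := fun i => by
    exact ((bddMeas_fluct_gamma hG hn hξ (hg i) hN).abs.pow _).integrable (P N) |>.const_mul _
  refine (integral_mono_of_nonneg (Eventually.of_forall fun ω => sq_nonneg _)
    (integrable_finsetSum Finset.univ fun i _ => hi i) (Eventually.of_forall fun ω => ?_)).trans ?_
  · refine (prod_sq_le_sum_pow hd _).trans (Finset.sum_le_sum fun i _ => ?_)
    rw [← mul_pow]
    exact pow_le_pow_left₀ (abs_nonneg _) (hA i N hN ω) _
  · rw [integral_finsetSum _ fun i _ => hi i]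
    refine Finset.sum_le_sum fun i _ => ?_
    rw [integral_const_mul]
    exact mul_le_mul_of_nonneg_left (hC i N hN) (pow_nonneg (hA0 i).le _)

end Family

/-! ### Integrability of products of limiting fields. -/

section LimitProduct

variable {E : ℕ → Type u} [∀ n, MeasurableSpace (E n)]
  {K : (n : ℕ) → Kernel (E n) (E (n + 1))} [∀ n, IsMarkovKernel (K n)]
  {G : (n : ℕ) → Path E n → ℝ} {x₀ : E 0} {n : ℕ}
  {Ω' : Type w} [MeasurableSpace Ω'] {P' : Measure Ω'} [IsProbabilityMeasure P']
  {W : (p : ℕ) → (Path E p → ℝ) → Ω' → ℝ}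

lemma IsLimitField.integrable_prod_sq (hW : IsLimitField K G x₀ P' n W) (hG : BddPotentials G)
    {d : ℕ} (hd : 1 ≤ d) {g : Fin d → Path E n → ℝ} (hg : ∀ i, BddMeas (g i)) :
    Integrable (fun ω => (∏ i, limitGam K G x₀ W n (g i) ω) ^ 2) P' := by
  have hm : ∀ i, AEStronglyMeasurable (limitGam K G x₀ W n (g i)) P' := fun i =>
    (hW.memLp_limitGam hG (hg i) (q := 1) (by simp)).1
  have hi : Integrable (fun ω => ∑ i, |limitGam K G x₀ W n (g i) ω| ^ (2 * d)) P' :=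
    integrable_finsetSum _ fun i _ => by
      simpa using (hW.memLp_limitGam hG (hg i) (q := (2 * d : ℕ))
        (ENNReal.natCast_ne_top _)).integrable_norm_pow'
  refine hi.mono' ?_ (Eventually.of_forall fun ω => ?_)
  · exact (Finset.aestronglyMeasurable_fun_prod _ fun i _ => hm i).pow 2
  · rw [Real.norm_eq_abs, abs_of_nonneg (sq_nonneg _)]
    exact prod_sq_le_sum_pow hd _

end LimitProduct

end FeynmanKac

end

/-! ### Conclusion: convergence in law and of expectations. -/

theorem lemma2p4
    -- state spaces, Markov transitions, initial point
    {E : ℕ → Type*} [∀ n, MeasurableSpace (E n)]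
    (K : (n : ℕ) → Kernel (E n) (E (n + 1))) [∀ n, IsMarkovKernel (K n)] (x₀ : E 0)
    -- positive measurable potentials with bounded ratios
    (G : (n : ℕ) → FeynmanKac.Path E n → ℝ)
    (hGmeas : ∀ n, 1 ≤ n → Measurable (G n))
    (hGpos : ∀ n, 1 ≤ n → ∀ y, 0 < G n y)
    (hGratio : ∀ n, 1 ≤ n → ∃ C : ℝ, ∀ y y', G n y / G n y' ≤ C)
    -- the particle systems, one for each number of particles
    {Ω : ℕ → Type*} [∀ N, MeasurableSpace (Ω N)] (P : (N : ℕ) → Measure (Ω N))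
    [∀ N, IsProbabilityMeasure (P N)]
    (ξ : (N : ℕ) → (p : ℕ) → Ω N → Fin N → FeynmanKac.Path E p)
    (hξ : ∀ N, 1 ≤ N → FeynmanKac.IsParticleSystem K G x₀ (P N) N (ξ N))
    (n d : ℕ) (hn : 1 ≤ n) (hd : 1 ≤ d)
    -- the independent Gaussian fields
    {Ω' : Type*} [MeasurableSpace Ω'] (P' : Measure Ω') [IsProbabilityMeasure P']
    (W : (p : ℕ) → (FeynmanKac.Path E p → ℝ) → Ω' → ℝ)
    (hW : FeynmanKac.IsLimitField K G x₀ P' n W)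
    -- test functions and kinds
    (f : Fin d → FeynmanKac.Path E n → ℝ) (hf : ∀ i, FeynmanKac.BddMeas (f i))
    (ν : Fin d → FeynmanKac.Kind) :
    TendstoInDistribution
        (fun N ω => ∏ i, FeynmanKac.fluct K G x₀ (ξ N) n (ν i) (f i) ω) atTop
        (fun ω => ∏ i, FeynmanKac.limitFluct K G x₀ W n (ν i) (f i) ω) P P' ∧
      (∀ N, Integrable (fun ω => ∏ i, FeynmanKac.fluct K G x₀ (ξ N) n (ν i) (f i) ω) (P N)) ∧
      Integrable (fun ω => ∏ i, FeynmanKac.limitFluct K G x₀ W n (ν i) (f i) ω) P' ∧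
      Tendsto
        (fun N => ∫ ω, ∏ i, FeynmanKac.fluct K G x₀ (ξ N) n (ν i) (f i) ω ∂(P N)) atTop
        (𝓝 (∫ ω, ∏ i, FeynmanKac.limitFluct K G x₀ W n (ν i) (f i) ω ∂P')) := by
  have hG := FeynmanKac.bddPotentials_of_ratio K x₀ hGmeas hGpos hGratio
  have hg := fun i => (hf i).centredFun (K := K) (G := G) (x₀ := x₀) (ν i)
  have hF := fun N i => FeynmanKac.bddMeas_fluct hG hn hξ (hf i) (ν i) N
  have hprod := fun N => FeynmanKac.BddMeas.prod Finset.univ fun i _ => hF N i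
  have hm : ∀ i, AEMeasurable
      (FeynmanKac.limitGam K G x₀ W n (FeynmanKac.centredFun K G x₀ n (ν i) (f i))) P' := fun i =>
    (hW.memLp_limitGam hG (hg i) (q := 1) (by simp)).1.aemeasurable
  simp_rw [FeynmanKac.limitFluct_eq]
  have hdist : TendstoInDistribution
      (fun N ω => ∏ i, FeynmanKac.fluct K G x₀ (ξ N) n (ν i) (f i) ω) atTop
      (fun ω => ∏ i, FeynmanKac.limitGam K G x₀ W n
        (FeynmanKac.centredFun K G x₀ n (ν i) (f i)) ω) P P' := by
    refine FeynmanKac.tendstoInDistribution_prod_of_charFun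
      (X := fun N i ω => FeynmanKac.fluct K G x₀ (ξ N) n (ν i) (f i) ω)
      (Z := fun i => FeynmanKac.limitGam K G x₀ W n (FeynmanKac.centredFun K G x₀ n (ν i) (f i)))
      (fun N i => (hF N i).1.aemeasurable) hm fun u => ?_
    rw [hW.integral_exp_sum_limitGam hG hg u]
    exact FeynmanKac.tendsto_charFun_fluct hG hn hξ hf ν u
  have hsq := hW.integrable_prod_sq hG hd hg
  obtain ⟨C, hC⟩ := FeynmanKac.exists_integral_prod_fluct_sq_le hG hn hξ hd hf ν
  refine ⟨hdist, fun N => (hprod N).integrable (P N), ?_, ?_⟩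
  · exact ((memLp_two_iff_integrable_sq hdist.aemeasurable_limit.aestronglyMeasurable).2
      hsq).integrable one_le_two
  -- The uniform second-moment bound on the products plays the role of uniform integrability.
  · exact FeynmanKac.tendsto_integral_of_tendstoInDistribution hdist (C := C)
      ((eventually_ge_atTop 1).mono fun N hN => ⟨(hprod N).sq.integrable (P N), hC N hN⟩) hsq
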